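/- Let $k$ be a field and let $A$ be a finite-dimensional local $k$-algebra (associative, unital, not necessarily commutative). Let $D^b(A)$ be the bounded derived category of finitely generated left $A$-modules. Call an object $X$ of $D^b(A)$ *compact* if $\operatorname{Hom}(X,-)$ commutes with small coproducts, where $X$ is regarded as an object of the unbounded derived category $D(\mathrm{Mod}\,A)$ of all left $A$-modules, and *exceptional* if $\operatorname{Hom}_{D^b(A)}(X,X[n])=0$ for all integers $n\neq 0$. (1) Every nonzero indecomposable compact exceptional object $X$ of $D^b(A)$ is isomorphic in $D^b(A)$ to $A[n]$ for some $n\in\mathbb Z$, where $A$ is viewed as a stalk complex in degree $0$. (2) $A$ is derived equivalent only to itself up to Morita equivalence: if $\Gamma$ is a finite-dimensional $k$-algebra such that $D^b(A)$ and $D^b(\Gamma)$ are equivalent as triangulated categories, then $A$ and $\Gamma$ are Morita equivalent as rings; if the triangulated equivalence can be chosen $k$-linear, then $A$ and $\Gamma$ are Morita equivalent as $k$-algebras. -/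

import Mathlib

open CategoryTheory CategoryTheory.Limits
open scoped ModuleCat.Algebra

universe v u w w₁ w₂ w₃

namespace DerivedLocal

/-- An object `X` of a preadditive category is compact (relative to the universe `w`) if
`Hom(X, -)`, as a functor to abelian groups, commutes with all coproducts indexed by types in
the universe `w`. -/
def IsCompactObject {T : Type u} [Category.{v} T] [Preadditive T] (X : T) : Prop :=
  ∀ J : Type w, PreservesColimitsOfShape (Discrete J) (preadditiveCoyoneda.obj (Opposite.op X))

/-- An object `X` of a category with shift is exceptional (or rigid) if `Hom(X, X[n]) = 0` for
all integers `n ≠ 0`. -/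
def IsExceptional {T : Type u} [Category.{v} T] [Preadditive T] [HasShift T ℤ] (X : T) : Prop :=
  ∀ n : ℤ, n ≠ 0 → ∀ f : X ⟶ X⟦n⟧, f = 0

section Module

variable (A : Type u) [Ring A] [IsNoetherianRing A] [HasDerivedCategory.{w₁} (FGModuleCat.{u} A)]

/-- The bounded derived category `D^b(A)` of the abelian category of finitely generated left
modules over a left noetherian ring `A`. -/
abbrev Db : Type (u + 1) := DerivedCategory.Bounded (FGModuleCat.{u} A)

/-- The left regular module `A`, as a stalk complex in degree `0`, in `D^b(A)`. -/
noncomputable def stalk : Db A :=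
  ⟨(DerivedCategory.singleFunctor (FGModuleCat.{u} A) 0).obj (FGModuleCat.of A A),
    ⟨0, inferInstance⟩, ⟨0, inferInstance⟩⟩

instance forget₂_additive : (forget₂ (FGModuleCat.{u} A) (ModuleCat.{u} A)).Additive where

/-- The canonical functor from `D^b(A)` to the unbounded derived category `D(Mod A)` of all left
`A`-modules, induced by the (exact) inclusion of the finitely generated modules. -/
noncomputable abbrev toDerivedMod [HasDerivedCategory.{w₂} (ModuleCat.{u} A)] :
    Db A ⥤ DerivedCategory (ModuleCat.{u} A) :=
  DerivedCategory.Bounded.ι ⋙ (forget₂ (FGModuleCat.{u} A) (ModuleCat.{u} A)).mapDerivedCategory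

variable {A}

/-- Compactness of an object `X` of `D^b(A)`: `Hom(X, -)` commutes with small coproducts.  The
coproducts are those of `D(Mod A)`, since `D^b(A)` itself has no infinite coproducts of nonzero
objects when `A` is a finite-dimensional algebra. -/
def IsCompact [HasDerivedCategory.{w₂} (ModuleCat.{u} A)] (X : Db A) : Prop :=
  IsCompactObject.{w₂, u + 1, u} ((toDerivedMod A).obj X)

end Module

/-- Two triangulated categories are triangle equivalent. -/
def TriangleEquivalent (C D : Type u) [Category.{v} C] [Category.{w} D]
    [Preadditive C] [HasZeroObject C] [HasShift C ℤ]
    [∀ n : ℤ, (shiftFunctor C n).Additive] [Pretriangulated C]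
    [Preadditive D] [HasZeroObject D] [HasShift D ℤ]
    [∀ n : ℤ, (shiftFunctor D n).Additive] [Pretriangulated D] : Prop :=
  ∃ (e : C ≌ D) (_ : e.functor.CommShift ℤ), e.functor.IsTriangulated

/-- Two `k`-linear triangulated categories are equivalent by a `k`-linear triangle equivalence. -/
def LinearTriangleEquivalent (k : Type w₁) [Ring k] (C D : Type u) [Category.{v} C] [Category.{w} D]
    [Preadditive C] [HasZeroObject C] [HasShift C ℤ]
    [∀ n : ℤ, (shiftFunctor C n).Additive] [Pretriangulated C] [CategoryTheory.Linear k C]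
    [Preadditive D] [HasZeroObject D] [HasShift D ℤ]
    [∀ n : ℤ, (shiftFunctor D n).Additive] [Pretriangulated D] [CategoryTheory.Linear k D] :
    Prop :=
  ∃ (e : C ≌ D) (_ : e.functor.CommShift ℤ), e.functor.IsTriangulated ∧ e.functor.Linear k

end DerivedLocal

/-!
For an object `X` of `D^b(A)`, write `S` for the simple `A`-module and `S[-m]` for the stalk complex
of `S` in degree `m`. Both parts rest on the same fact: a nonzero exceptional `X` with
`Hom(X, S[-m]) = 0` for `m ≪ 0` is a shift of a free module `A ^ n`
(`exists_iso_boundedSingle`). To see this, let `b` be the top cohomological degree of `X`, and `c` the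
least integer with `Hom(X, S[-c]) ≠ 0`, so that `c ≤ b`. As every nonzero module maps onto `S`,
induction on the length gives `Hom(X, Y) = 0` for all bounded `Y` concentrated in degrees `< c`.
Hence a nonzero map `X ⟶ S[-c]` lifts to the stalk `Hᵇ(X)[-c]` and further to `X[b - c]`, of which
that stalk is the top truncation. Since `X` is exceptional, `b = c`
(`IsUniversalTop.hom_eq_zero_of_exceptional`). Now lift a projective cover of `Hᵇ(X)` to a map
`A ^ n[-b] ⟶ X`; its cone has no maps to any `S[-m]`, hence is zero
(`IsUniversalTop.exists_iso_single`).

For the second part, let `X` correspond to `Γ` under the equivalence. It is exceptional, and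
`Hom(X, S[-m])` is a group of morphisms from `Γ` to a shift of a fixed bounded complex of
`Γ`-modules, so it vanishes for `m ≪ 0`. Therefore `X` is a shift of `A ^ n`, and comparing
endomorphism algebras shows that `Γ` is an algebra of `n × n` matrices over `A`.

For the first part, the vanishing for `m ≪ 0` is deduced from compactness
(`IsCompact.exists_hom_single_eq_zero`). Let `P` be a projective resolution of `S`. The coproduct of
the complexes `P[j]`, `j ≥ 0`, is a coproduct in `D(Mod A)` because all of them are K-projective
(`isColimit_Q_sigma`), and it is locally finite. So if `X ⟶ S[j]` is nonzero for infinitely many `j`,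
then these maps, computed on a K-projective model of `X`, are the components of a morphism from `X`
to the coproduct (`exists_lift_sigma`), which is impossible for compact `X`
(`IsCompactObject.finite_support`). The conclusion is transported back from `D(Mod A)` by the
injectivity of `Hom_{D^b(A)}(X, S[-m]) → Hom_{D(Mod A)}(X, S[-m])` (`mapDerivedCategory_eq_zero`).
Finally, an indecomposable `A ^ n` has `n = 1`.
-/

namespace DerivedLocal

open Pretriangulated DerivedCategory.TStructure

/-! ### Exact sequences of morphisms attached to a distinguished triangle -/

section Pretriangulated

variable {T : Type u} [Category.{v} T] [Preadditive T] [HasZeroObject T] [HasShift T ℤ]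
  [∀ n : ℤ, (shiftFunctor T n).Additive] [Pretriangulated T]
  {X Y Z W : T} {f : X ⟶ Y} {g : Y ⟶ Z} {h : Z ⟶ X⟦(1 : ℤ)⟧}

lemma distinguished_comp_eq_zero₁₂ (hT : Triangle.mk f g h ∈ distTriang T) : f ≫ g = 0 :=
  comp_distTriang_mor_zero₁₂ _ hT

lemma distinguished_comp_eq_zero₂₃ (hT : Triangle.mk f g h ∈ distTriang T) : g ≫ h = 0 :=
  comp_distTriang_mor_zero₂₃ _ hT

lemma distinguished_comp_eq_zero₃₁ (hT : Triangle.mk f g h ∈ distTriang T) :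
    h ≫ f⟦(1 : ℤ)⟧' = 0 :=
  comp_distTriang_mor_zero₃₁ _ hT

lemma exists_desc₂ (hT : Triangle.mk f g h ∈ distTriang T) (x : Y ⟶ W) (hx : f ≫ x = 0) :
    ∃ y : Z ⟶ W, x = g ≫ y :=
  Triangle.yoneda_exact₂ _ hT x hx

lemma exists_desc₃ (hT : Triangle.mk f g h ∈ distTriang T) (x : Z ⟶ W) (hx : g ≫ x = 0) :
    ∃ y : X⟦(1 : ℤ)⟧ ⟶ W, x = h ≫ y :=
  Triangle.yoneda_exact₃ _ hT x hx

lemma exists_lift₂ (hT : Triangle.mk f g h ∈ distTriang T) (x : W ⟶ Y) (hx : x ≫ g = 0) :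
    ∃ y : W ⟶ X, x = y ≫ f :=
  Triangle.coyoneda_exact₂ _ hT x hx

lemma exists_lift₃ (hT : Triangle.mk f g h ∈ distTriang T) (x : W ⟶ Z) (hx : x ≫ h = 0) :
    ∃ y : W ⟶ Y, x = y ≫ g :=
  Triangle.coyoneda_exact₃ _ hT x hx

lemma distinguished_of_iso₃ {Z' : T} (hT : Triangle.mk f g h ∈ distTriang T) (e : Z ≅ Z') :
    Triangle.mk f (g ≫ e.hom) (e.inv ≫ h) ∈ distTriang T :=
  isomorphic_distinguished _ hT _
    (Triangle.isoMk _ _ (Iso.refl X) (Iso.refl Y) e.symm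
      (show f ≫ 𝟙 Y = 𝟙 X ≫ f by simp) (show (g ≫ e.hom) ≫ e.inv = 𝟙 Y ≫ g by simp)
      (show (e.inv ≫ h) ≫ (𝟙 X)⟦(1 : ℤ)⟧' = e.inv ≫ h by simp))

end Pretriangulated

section Abelian

variable {C : Type u} [Category.{v} C] [Abelian C] [HasDerivedCategory.{w} C]

/-! ### Stalk complexes and truncation triangles -/

/-- The isomorphism `M[-b][a] ≅ M[-m]`, where `a + m = b`. -/
noncomputable def singleShiftIso (M : C) (a m b : ℤ) (h : a + m = b) :
    ((DerivedCategory.singleFunctor C b).obj M)⟦a⟧ ≅ (DerivedCategory.singleFunctor C m).obj M :=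
  ((DerivedCategory.singleFunctors C).shiftIso a m b h).app M

lemma hom_single_projective_eq_zero {P : C} [Projective P] {Y : DerivedCategory C} {n i : ℤ}
    [Y.IsLE n] (h : n < i) (f : (DerivedCategory.singleFunctor C i).obj P ⟶ Y) : f = 0 := by
  obtain ⟨K, _, ⟨e⟩⟩ := Y.exists_iso_Q_obj_of_isLE n
  have : f ≫ e.hom = 0 := DerivedCategory.from_singleFunctor_obj_eq_zero_of_projective
    (P := P) (L := K) (i := i) (f ≫ e.hom) n h
  rwa [← cancel_mono e.hom, zero_comp]

/-- Between stalk complexes in different degrees there are no morphisms out of a projective. -/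
lemma hom_single_projective_single_eq_zero {P M : C} [Projective P] {i n : ℤ} (h : n ≠ i)
    (f : (DerivedCategory.singleFunctor C i).obj P ⟶ (DerivedCategory.singleFunctor C n).obj M) :
    f = 0 := by
  rcases h.lt_or_gt with h | h
  · exact hom_single_projective_eq_zero h f
  · exact t.zero f i n h

lemma exists_single_triangle {T : ShortComplex C} (hT : T.ShortExact) (n : ℤ) :
    ∃ δ, Triangle.mk ((DerivedCategory.singleFunctor C n).map T.f)
      ((DerivedCategory.singleFunctor C n).map T.g) δ ∈ distTriang (DerivedCategory C) :=
  ⟨_, DerivedCategory.triangleOfSES_distinguished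
    (hT.map_of_exact (HomologicalComplex.single C (ComplexShape.up ℤ) n))⟩

/-- The top cohomology of an object `X ≤ b`, together with the truncation triangle. -/
lemma exists_top_triangle (X : DerivedCategory C) (b : ℤ) [X.IsLE b] :
    ∃ (X' : DerivedCategory C) (M : C) (i : X' ⟶ X)
      (p : X ⟶ (DerivedCategory.singleFunctor C b).obj M)
      (δ : (DerivedCategory.singleFunctor C b).obj M ⟶ X'⟦(1 : ℤ)⟧),
      Triangle.mk i p δ ∈ distTriang (DerivedCategory C) ∧ X'.IsLE (b - 1) ∧
        ∀ a : ℤ, X.IsGE a → X'.IsGE a := by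
  obtain ⟨M, ⟨e⟩⟩ :=
    ((t.truncGE b).obj X).exists_iso_singleFunctor_obj_of_isGE_of_isLE b
  refine ⟨(t.truncLT b).obj X, M, (t.truncLTι b).app X, (t.truncGEπ b).app X ≫ e.hom,
    e.inv ≫ (t.truncGEδLT b).app X, ?_, inferInstance, fun a _ => inferInstance⟩
  exact distinguished_of_iso₃ (t.triangleLTGE_distinguished b X) e

lemma isLE_of_top_isZero {X X' : DerivedCategory C} {M : C} {b : ℤ} {i : X' ⟶ X}
    {p : X ⟶ (DerivedCategory.singleFunctor C b).obj M}
    {δ : (DerivedCategory.singleFunctor C b).obj M ⟶ X'⟦(1 : ℤ)⟧}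
    (hT : Triangle.mk i p δ ∈ distTriang (DerivedCategory C)) (hX' : X'.IsLE (b - 1))
    (hM : IsZero M) : X.IsLE (b - 1) := by
  have : IsIso i := (Triangle.isZero₃_iff_isIso₁ _ hT).1 
    ((DerivedCategory.singleFunctor C b).map_isZero hM)
  exact t.isLE_of_iso (asIso i) (b - 1)

/-- Induction on the cohomological amplitude, keeping track of an upper bound for the object. -/
lemma bounded_induction (p : DerivedCategory C → ℤ → Prop) (h₀ : ∀ X b, IsZero X → p X b)
    (hs : ∀ (X' X : DerivedCategory C) (M : C) (b : ℤ) (i : X' ⟶ X)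
      (q : X ⟶ (DerivedCategory.singleFunctor C b).obj M)
      (δ : (DerivedCategory.singleFunctor C b).obj M ⟶ X'⟦(1 : ℤ)⟧),
      Triangle.mk i q δ ∈ distTriang (DerivedCategory C) → p X' (b - 1) → p X b)
    (X : DerivedCategory C) (a b : ℤ) [X.IsGE a] [X.IsLE b] : p X b := by
  obtain ⟨n, hn⟩ : ∃ n : ℕ, b < a + n := ⟨(b - a + 1).toNat, by lia⟩
  induction n generalizing X b with
  | zero => exact h₀ _ _ (t.isZero X b a (by lia))
  | succ n ih =>
    obtain ⟨X', M, i, q, δ, hT, h₁, h₂⟩ := exists_top_triangle X b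
    have := h₂ a inferInstance
    exact hs X' X M b i q δ hT (ih X' (b - 1) (by push_cast at hn; lia))

/-- A surjection `P ⟶ Hᵇ(X)` with `P` projective and `X ≤ b` lifts to `P[-b] ⟶ X`; the cone of
any such lift is `≤ b - 1`. -/
lemma exists_projective_triangle {X X' : DerivedCategory C} {M : C} {b : ℤ} {i : X' ⟶ X}
    {p : X ⟶ (DerivedCategory.singleFunctor C b).obj M}
    {δ : (DerivedCategory.singleFunctor C b).obj M ⟶ X'⟦(1 : ℤ)⟧}
    (hT : Triangle.mk i p δ ∈ distTriang (DerivedCategory C)) 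
    (hX' : X'.IsLE (b - 1)) {P : C} [Projective P] (π : P ⟶ M) [Epi π] :
    ∃ (Z : DerivedCategory C) (q : (DerivedCategory.singleFunctor C b).obj P ⟶ X) (r : X ⟶ Z)
      (ε : Z ⟶ ((DerivedCategory.singleFunctor C b).obj P)⟦(1 : ℤ)⟧),
      Triangle.mk q r ε ∈ distTriang (DerivedCategory C) ∧ Z.IsLE (b - 1) ∧
        q ≫ p = (DerivedCategory.singleFunctor C b).map π := by
  have : (X'⟦(1 : ℤ)⟧).IsLE (b - 2) := t.isLE_shift X' (b - 1) 1 (b - 2)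
  obtain ⟨q, hq⟩ := exists_lift₃ hT ((DerivedCategory.singleFunctor C b).map π)
    (hom_single_projective_eq_zero (n := b - 2) (by lia) _)
  obtain ⟨Z, r, ε, hZ⟩ := distinguished_cocone_triangle q
  refine ⟨Z, q, r, ε, hZ, ?_, hq.symm⟩
  rw [DerivedCategory.IsLE, t.isLE_iff_orthogonal (b - 1) b (by lia)]
  intro Y f hY
  -- `X ⟶ Z ⟶ Y` factors through `Hᵇ(X)[-b]`, and then vanishes because `π` is an epimorphism.
  have hrf : r ≫ f = 0 := by
    obtain ⟨g, hg⟩ := exists_desc₂ hT (r ≫ f) (t.zero _ (b - 1) b (by lia))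
    obtain ⟨δ', hδ'⟩ := exists_single_triangle
      (T := ShortComplex.mk (kernel.ι π) π (kernel.condition π))
      { exact := ShortComplex.exact_of_f_is_kernel _ (kernelIsKernel π) } b
    have hg' : (DerivedCategory.singleFunctor C b).map π ≫ g = 0 := by
      have h0 := distinguished_comp_eq_zero₁₂ hZ
      rw [hq, Category.assoc, ← hg, reassoc_of% h0, zero_comp]
    obtain ⟨k, hk⟩ := exists_desc₃ hδ' g hg'
    have : (((DerivedCategory.singleFunctor C b).obj (kernel π))⟦(1 : ℤ)⟧).IsLE (b - 1) :=
      t.isLE_shift _ b 1 (b - 1)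
    rw [hg, hk, t.zero k (b - 1) b (by lia), comp_zero, comp_zero]
  obtain ⟨k, hk⟩ := exists_desc₃ hZ f hrf
  have : (((DerivedCategory.singleFunctor C b).obj P)⟦(1 : ℤ)⟧).IsLE (b - 1) :=
    t.isLE_shift _ b 1 (b - 1)
  rw [hk, t.zero k (b - 1) b (by lia), comp_zero]

end Abelian

end DerivedLocal

namespace DerivedLocal

open Pretriangulated DerivedCategory.TStructure

section SimpleTop

variable {C : Type u} [Category.{v} C] [Abelian C]

/-! ### Abelian categories with one simple object -/

/-- `S` is a nonzero object, every nonzero object maps onto `S`, and the length function `ℓ`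
witnesses that repeatedly passing to the kernel of such a map terminates. For finite length
modules over a local ring, `S` is the simple module. -/
structure IsUniversalTop (S : C) (ℓ : C → ℕ) : Prop where
  not_isZero : ¬ IsZero S
  exists_shortExact (M : C) (hM : ¬ IsZero M) :
    ∃ (K : C) (i : K ⟶ M) (p : M ⟶ S) (hw : i ≫ p = 0),
      (ShortComplex.mk i p hw).ShortExact ∧ ℓ K < ℓ M

variable [HasDerivedCategory.{w} C] {S : C} {ℓ : C → ℕ}

lemma exists_isLE_not_isLE (X : DerivedCategory C) (hX : ¬ IsZero X) (a b : ℤ) [X.IsGE a]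
    [X.IsLE b] : ∃ c, X.IsLE c ∧ ¬ X.IsLE (c - 1) := by
  obtain ⟨c, hc, hmin⟩ := Int.exists_least_of_bdd (P := fun c => X.IsLE c)
    ⟨a, fun c hc => by
      by_contra h
      exact hX (t.isZero X c a (by lia))⟩ ⟨b, inferInstance⟩
  exact ⟨c, hc, fun h => by have := hmin _ h; lia⟩

lemma IsUniversalTop.exists_hom_ne_zero (hS : IsUniversalTop S ℓ) {X : DerivedCategory C} {b : ℤ}
    (hX : X.IsLE b) (hX' : ¬ X.IsLE (b - 1)) :
    ∃ f : X ⟶ (DerivedCategory.singleFunctor C b).obj S, f ≠ 0 := by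
  obtain ⟨X', M, i, q, δ, hT, h₁, -⟩ := exists_top_triangle X b
  obtain ⟨K, j, p, hw, hses, -⟩ :=
    hS.exists_shortExact M fun h => hX' (isLE_of_top_isZero hT h₁ h)
  refine ⟨q ≫ (DerivedCategory.singleFunctor C b).map p, fun h => hS.not_isZero ?_⟩
  obtain ⟨k, hk⟩ := exists_desc₃ hT _ h
  have : (X'⟦(1 : ℤ)⟧).IsLE (b - 2) := t.isLE_shift X' (b - 1) 1 (b - 2)
  rw [t.zero k (b - 2) b (by lia), comp_zero] at hk
  have hp : p = 0 := (DerivedCategory.singleFunctor C b).map_injective (by rw [hk, Functor.map_zero])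
  have : Epi p := hses.epi_g
  exact IsZero.of_epi_eq_zero p hp

lemma IsUniversalTop.isZero_of_hom_eq_zero (hS : IsUniversalTop S ℓ) (X : DerivedCategory C)
    (a b : ℤ) [X.IsGE a] [X.IsLE b]
    (h : ∀ (m : ℤ) (f : X ⟶ (DerivedCategory.singleFunctor C m).obj S), f = 0) : IsZero X := by
  by_contra hX
  obtain ⟨c, hc, hc'⟩ := exists_isLE_not_isLE X hX a b
  obtain ⟨f, hf⟩ := hS.exists_hom_ne_zero hc hc'
  exact hf (h c f)

lemma IsUniversalTop.hom_single_eq_zero (hS : IsUniversalTop S ℓ) {X : DerivedCategory C} {m : ℤ}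
    (hX : ∀ f : X ⟶ (DerivedCategory.singleFunctor C m).obj S, f = 0)
    (M : C) (f : X ⟶ (DerivedCategory.singleFunctor C m).obj M) : f = 0 := by
  induction hn : ℓ M using Nat.strong_induction_on generalizing M with
  | _ n ih =>
    by_cases hM : IsZero M
    · exact ((DerivedCategory.singleFunctor C m).map_isZero hM).eq_of_tgt _ _
    obtain ⟨K, j, p, hw, hses, hlt⟩ := hS.exists_shortExact M hM
    obtain ⟨δ, hδ⟩ := exists_single_triangle hses m
    obtain ⟨g, hg⟩ := exists_lift₂ hδ f (hX _)
    rw [hg, ih _ (hn ▸ hlt) K g rfl, zero_comp]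

lemma IsUniversalTop.hom_eq_zero (hS : IsUniversalTop S ℓ) {X : DerivedCategory C} {N : ℤ}
    (hX : ∀ m < N, ∀ f : X ⟶ (DerivedCategory.singleFunctor C m).obj S, f = 0)
    (Y : DerivedCategory C) (a b : ℤ) [Y.IsGE a] [Y.IsLE b] (hb : b < N) (f : X ⟶ Y) : f = 0 := by
  refine bounded_induction (fun Y b => b < N → ∀ f : X ⟶ Y, f = 0)
    (fun Y b hY _ f => hY.eq_of_tgt _ _) ?_ Y a b hb f
  intro Y' Y M b i q δ hT ih hb f
  obtain ⟨g, hg⟩ := exists_lift₂ hT f (hS.hom_single_eq_zero (hX b hb) M _)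
  rw [hg, ih (by lia) g, zero_comp]

/-- Let `b` be the top degree of `X` and `c` the least degree with `Hom(X, S[-c]) ≠ 0`. Any nonzero
map `X ⟶ S[-c]` lifts along `X[b - c] ⟶ Hᵇ(X)[-c] ⟶ S[-c]`, since the obstructions live in groups
which vanish by minimality of `c`. So for exceptional `X` one has `c = b`. -/
lemma IsUniversalTop.hom_eq_zero_of_exceptional (hS : IsUniversalTop S ℓ) {X : DerivedCategory C}
    {a b N : ℤ} [X.IsGE a] [X.IsLE b] (hb : ¬ X.IsLE (b - 1))
    (hN : ∀ m < N, ∀ f : X ⟶ (DerivedCategory.singleFunctor C m).obj S, f = 0)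
    (hX : ∀ n : ℤ, n ≠ 0 → ∀ f : X ⟶ X⟦n⟧, f = 0) {m : ℤ} (hm : m ≠ b)
    (f : X ⟶ (DerivedCategory.singleFunctor C m).obj S) : f = 0 := by
  rcases hm.lt_or_gt with hm | hm
  swap
  · exact t.zero f b m hm
  by_contra hf
  obtain ⟨c, ⟨f, hf⟩, hmin⟩ := Int.exists_least_of_bdd
    (P := fun c => ∃ f : X ⟶ (DerivedCategory.singleFunctor C c).obj S, f ≠ 0)
    ⟨N, fun c ⟨f, hf⟩ => by
      by_contra h
      exact hf (hN c (by lia) f)⟩ ⟨m, f, hf⟩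
  have hcm := hmin m ⟨_, ‹_›⟩
  have hc : ∀ m < c, ∀ f : X ⟶ (DerivedCategory.singleFunctor C m).obj S, f = 0 := by
    intro m hm f
    by_contra hf
    have := hmin m ⟨f, hf⟩
    lia
  have hY : (X⟦b - c⟧).IsLE c := t.isLE_shift X b (b - c) c
  have hY' : ¬ (X⟦b - c⟧).IsLE (c - 1) := by
    rwa [DerivedCategory.IsLE, t.isLE_shift_iff X (b - 1) (b - c) (c - 1)]
  have hYa : (X⟦b - c⟧).IsGE (a - (b - c)) := t.isGE_shift X a (b - c) _
  obtain ⟨Y', M, i, q, δ, hT, h₁, h₂⟩ := exists_top_triangle (X⟦b - c⟧) c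
  have := h₂ _ hYa
  have : (Y'⟦(1 : ℤ)⟧).IsLE (c - 2) := t.isLE_shift Y' (c - 1) 1 (c - 2)
  have : (Y'⟦(1 : ℤ)⟧).IsGE (a - (b - c) - 1) := t.isGE_shift Y' (a - (b - c)) 1 _
  obtain ⟨K, j, p, hw, hses, -⟩ :=
    hS.exists_shortExact M fun h => hY' (isLE_of_top_isZero hT h₁ h)
  obtain ⟨ε, hε⟩ := exists_single_triangle hses c
  have hfε : f ≫ ε = 0 := by
    rw [← cancel_mono (singleShiftIso K 1 (c - 1) c (by lia)).hom, zero_comp]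
    exact hS.hom_single_eq_zero (hc _ (by lia)) K _
  obtain ⟨g, hg⟩ := exists_lift₃ hε f hfε
  obtain ⟨h, hh⟩ := exists_lift₃ hT g
    (hS.hom_eq_zero hc _ (a - (b - c) - 1) (c - 2) (by lia) _)
  rw [hX (b - c) (by lia) h, zero_comp] at hh
  rw [hh, zero_comp] at hg
  exact hf hg

/-- If `Hom(X, S[-m])` vanishes for all `m` except the top degree `b` of `X`, then the cone of a
lift `P[-b] ⟶ X` of a projective cover `P ⟶ Hᵇ(X)` has no morphisms to any `S[-m]`, hence is zero.
The minimality of the cover enters as the hypothesis that maps `P ⟶ S` factor through it. -/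
lemma IsUniversalTop.exists_iso_single (hS : IsUniversalTop S ℓ) {X : DerivedCategory C}
    {a b : ℤ} [X.IsGE a] [X.IsLE b]
    (hX : ∀ m ≠ b, ∀ f : X ⟶ (DerivedCategory.singleFunctor C m).obj S, f = 0)
    (p : C → Prop)
    (hp : ∀ M : C, ∃ (P : C) (π : P ⟶ M), p P ∧ Projective P ∧ Epi π ∧
      ∀ g : P ⟶ S, ∃ g' : M ⟶ S, g = π ≫ g') :
    ∃ P : C, p P ∧ Nonempty (X ≅ (DerivedCategory.singleFunctor C b).obj P) := by
  obtain ⟨X', M, i, q, δ, hT, h₁, -⟩ := exists_top_triangle X b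
  obtain ⟨P, π, hP, _, _, hπ⟩ := hp M
  obtain ⟨Z, s, r, ε, hZ, hZb, hs⟩ := exists_projective_triangle hT h₁ π
  refine ⟨P, hP, ⟨?_⟩⟩
  suffices IsZero Z by
    have : IsIso s := (Triangle.isZero₃_iff_isIso₁ _ hZ).1 this
    exact (asIso s).symm
  have hP₁ : (((DerivedCategory.singleFunctor C b).obj P)⟦(1 : ℤ)⟧).IsGE (b - 1) :=
    t.isGE_shift _ b 1 (b - 1)
  have hP₂ : (((DerivedCategory.singleFunctor C b).obj P)⟦(1 : ℤ)⟧).IsLE (b - 1) :=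
    t.isLE_shift _ b 1 (b - 1)
  have hP₃ : (((DerivedCategory.singleFunctor C b).obj P)⟦(1 : ℤ)⟧).IsGE (min a (b - 1)) :=
    t.isGE_of_ge _ _ (b - 1)
  have hZa : Z.IsGE (min a (b - 1)) :=
    t.isGE₂ _ (rot_of_distTriang _ hZ) _ (t.isGE_of_ge X _ a) hP₃
  refine hS.isZero_of_hom_eq_zero Z (min a (b - 1)) (b - 1) fun m f => ?_
  have hrf : r ≫ f = 0 := by
    by_cases hm : m = b
    · subst hm
      obtain ⟨g, hg⟩ := exists_desc₂ hT (r ≫ f) (t.zero _ (m - 1) m (by lia))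
      obtain ⟨g, rfl⟩ := (DerivedCategory.singleFunctor C m).map_surjective g
      have h0 : (DerivedCategory.singleFunctor C m).map (π ≫ g) = 0 := by
        rw [Functor.map_comp, ← hs, Category.assoc, ← hg, ← Category.assoc,
          distinguished_comp_eq_zero₁₂ hZ, zero_comp]
      rw [hg, zero_of_epi_comp π ((DerivedCategory.singleFunctor C m).map_injective
        (h0.trans (Functor.map_zero _ _ _).symm)), Functor.map_zero, comp_zero]
    · exact hX m hm _
  obtain ⟨k, rfl⟩ := exists_desc₃ hZ f hrf
  by_cases hm : m = b - 1
  · -- `k : P[1 - b] ⟶ S[1 - b]` comes from a map `P ⟶ S`, so it extends to `X[1]`.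
    subst hm
    obtain ⟨g, hg⟩ := (DerivedCategory.singleFunctor C b).map_surjective
      ((shiftFunctor (DerivedCategory C) (1 : ℤ)).preimage
        (k ≫ (singleShiftIso S 1 (b - 1) b (by lia)).inv))
    obtain ⟨g', rfl⟩ := hπ g
    have hk : ((DerivedCategory.singleFunctor C b).map (π ≫ g'))⟦(1 : ℤ)⟧' =
        k ≫ (singleShiftIso S 1 (b - 1) b (by lia)).inv := by
      rw [hg, Functor.map_preimage]
    rw [← cancel_mono (singleShiftIso S 1 (b - 1) b (by lia)).inv, Category.assoc, ← hk,
      Functor.map_comp, ← hs, Category.assoc, Functor.map_comp, ← Category.assoc,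
      distinguished_comp_eq_zero₃₁ hZ, zero_comp, zero_comp]
  · have : k = 0 := by
      rw [← cancel_epi (singleShiftIso P 1 (b - 1) b (by lia)).inv, comp_zero]
      exact hom_single_projective_single_eq_zero hm _
    rw [this, comp_zero]

end SimpleTop

end DerivedLocal

namespace DerivedLocal

section LocalRing

variable {A : Type u} [Ring A] [IsLocalRing A]

/-! ### Modules over a local ring -/

lemma isMaximal_unique {I J : Ideal A} (hI : I.IsMaximal) (hJ : J.IsMaximal) : I = J := by
  by_contra hne
  have h : I ⊔ J = ⊤ := hI.coprime_of_ne hJ hne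
  obtain ⟨x, hx, y, hy, hxy⟩ := Submodule.mem_sup.1 ((Ideal.eq_top_iff_one _).1 h)
  rcases IsLocalRing.isUnit_or_isUnit_of_add_one hxy with hu | hu
  · exact hI.ne_top (Ideal.eq_top_of_isUnit_mem _ hx hu)
  · exact hJ.ne_top (Ideal.eq_top_of_isUnit_mem _ hy hu)

lemma mem_of_not_isUnit [IsNoetherianRing A] {I : Ideal A} (hI : I.IsMaximal) {x : A}
    (hx : ¬ IsUnit x) : x ∈ I := by
  have hne : Ideal.span {x} ≠ ⊤ := by
    intro h
    obtain ⟨a, ha⟩ := Ideal.mem_span_singleton'.1 ((Ideal.eq_top_iff_one _).1 h)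
    exact hx (isUnit_of_mul_isUnit_right (ha ▸ isUnit_one))
  obtain ⟨J, hJ, hle⟩ := Ideal.exists_le_maximal _ hne
  rw [isMaximal_unique hI hJ]
  exact hle (Ideal.mem_span_singleton_self x)

lemma exists_surjective_quotient (I : Ideal A) (hI : I.IsMaximal) (M : Type u) [AddCommGroup M]
    [Module A M] [Module.Finite A M] [Nontrivial M] :
    ∃ f : M →ₗ[A] A ⧸ I, Function.Surjective f := by
  obtain ⟨N, hN⟩ := IsCoatomic.exists_coatom (Submodule A M)
  have : IsSimpleModule A (M ⧸ N) := isSimpleModule_iff_isCoatom.2 hN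
  obtain ⟨J, hJ, ⟨e⟩⟩ := isSimpleModule_iff_quot_maximal.1 this
  obtain rfl := isMaximal_unique hI hJ
  exact ⟨e.toLinearMap ∘ₗ N.mkQ, e.surjective.comp N.mkQ_surjective⟩

/-- Choose a surjection `Aⁿ ⟶ M` with `n` minimal. If a map from `Aⁿ` to the simple module did not
vanish at some `x` in the kernel, some coordinate of `x` would be a unit, and the corresponding
generator of `M` would be superfluous. -/
lemma exists_minimal_cover [IsNoetherianRing A] (I : Ideal A) (hI : I.IsMaximal)
    (M : Type u) [AddCommGroup M] [Module A M] [Module.Finite A M] :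
    ∃ (n : ℕ) (π : (Fin n → A) →ₗ[A] M), Function.Surjective π ∧
      ∀ g : (Fin n → A) →ₗ[A] A ⧸ I, LinearMap.ker π ≤ LinearMap.ker g := by
  classical
  have hex : ∃ (n : ℕ) (π : (Fin n → A) →ₗ[A] M), Function.Surjective π :=
    Module.Finite.exists_fin' A M
  obtain ⟨n, ⟨π, hπ⟩, hmin⟩ : ∃ n : ℕ, (∃ π : (Fin n → A) →ₗ[A] M, Function.Surjective π) ∧
      ∀ m < n, ¬ ∃ π : (Fin m → A) →ₗ[A] M, Function.Surjective π :=
    ⟨Nat.find hex, Nat.find_spec hex, fun m hm => Nat.find_min hex hm⟩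
  refine ⟨n, π, hπ, fun g x hx => ?_⟩
  rw [LinearMap.mem_ker] at hx ⊢
  by_contra hgx
  obtain ⟨i, hi⟩ : ∃ i, IsUnit (x i) := by
    by_contra! h
    refine hgx ?_
    rw [pi_eq_sum_univ x, map_sum]
    refine Finset.sum_eq_zero fun i _ => ?_
    rw [map_smul]
    obtain ⟨a, ha⟩ := Submodule.mkQ_surjective I (g fun j => if i = j then 1 else 0)
    rw [← ha, ← map_smul, Submodule.mkQ_apply, Submodule.Quotient.mk_eq_zero, smul_eq_mul]
    exact mem_of_not_isUnit hI fun hu => h i (isUnit_of_mul_isUnit_left hu)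
  cases n with
  | zero => exact i.elim0
  | succ n =>
    refine hmin n (by lia)
      ⟨π ∘ₗ Function.ExtendByZero.linearMap A i.succAbove, fun m => ?_⟩
    obtain ⟨y, rfl⟩ := hπ m
    obtain ⟨c, hc⟩ := hi.exists_left_inv
    -- Subtract a multiple of `x` from `y` to kill its `i`-th coordinate.
    set z : Fin (n + 1) → A := y - (y i * c) • x with hz
    have hzi : z i = 0 := by simp [hz, mul_assoc, hc]
    refine ⟨z ∘ i.succAbove, ?_⟩
    have : Function.ExtendByZero.linearMap A i.succAbove (z ∘ i.succAbove) = z := by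
      funext j
      rcases eq_or_ne j i with rfl | hj
      · rw [Function.ExtendByZero.linearMap_apply, Function.extend_apply' _ _ _ (by
          rintro ⟨k, hk⟩
          exact Fin.succAbove_ne _ _ hk), hzi, Pi.zero_apply]
      · obtain ⟨k, rfl⟩ := Fin.exists_succAbove_eq hj
        rw [Function.ExtendByZero.linearMap_apply,
          Fin.succAbove_right_injective.extend_apply, Function.comp_apply]
    rw [LinearMap.comp_apply, this, hz, map_sub, map_smul, hx, smul_zero, sub_zero]

end LocalRing

section FGModuleCat

variable {A : Type u} [Ring A]

/-! ### The category of finitely generated modules over a local Artinian ring -/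

lemma fg_isZero_of_subsingleton (M : FGModuleCat.{u} A) [Subsingleton M] : IsZero M := by
  rw [IsZero.iff_id_eq_zero]
  ext x
  exact Subsingleton.elim (α := M) _ _

lemma fg_subsingleton_of_isZero {M : FGModuleCat.{u} A} (h : IsZero M) : Subsingleton M := by
  rw [IsZero.iff_id_eq_zero] at h
  refine ⟨fun x y => ?_⟩
  have h' : ∀ z : M, z = 0 := fun z => congrArg (fun f : M ⟶ M => f.hom z) h
  rw [h' x, h' y]

variable [IsNoetherianRing A]

lemma fg_epi_of_surjective {M N : FGModuleCat.{u} A} (f : M ⟶ N)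
    (hf : Function.Surjective f.hom) : Epi f := by
  have : Epi ((forget₂ (FGModuleCat.{u} A) (ModuleCat.{u} A)).map f) :=
    (ModuleCat.epi_iff_surjective _).2 hf
  exact (forget₂ (FGModuleCat.{u} A) (ModuleCat.{u} A)).epi_of_epi_map this

lemma fg_surjective_of_epi {M N : FGModuleCat.{u} A} (f : M ⟶ N) [Epi f] :
    Function.Surjective f.hom :=
  (ModuleCat.epi_iff_surjective _).1
    (inferInstanceAs (Epi ((forget₂ (FGModuleCat.{u} A) (ModuleCat.{u} A)).map f)))

instance fg_projective (M : Type u) [AddCommGroup M] [Module A M] [Module.Finite A M]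
    [Module.Projective A M] : Projective (FGModuleCat.of A M) where
  factors {E X} f e _ := by
    obtain ⟨g, hg⟩ := Module.projective_lifting_property e.hom.hom f.hom.hom
      (fg_surjective_of_epi e)
    refine ⟨FGModuleCat.ofHom g, ?_⟩
    ext x
    exact LinearMap.congr_fun hg x

variable [IsLocalRing A]

lemma exists_projective_cover (I : Ideal A) (hI : I.IsMaximal) (M : FGModuleCat.{u} A) :
    ∃ (P : FGModuleCat.{u} A) (π : P ⟶ M), (∃ n : ℕ, P = FGModuleCat.of A (Fin n → A)) ∧
      Projective P ∧ Epi π ∧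
        ∀ g : P ⟶ FGModuleCat.of A (A ⧸ I), ∃ g' : M ⟶ FGModuleCat.of A (A ⧸ I), g = π ≫ g' := by
  obtain ⟨n, π, hπ, h⟩ := exists_minimal_cover I hI M
  refine ⟨FGModuleCat.of A (Fin n → A), FGModuleCat.ofHom π, ⟨n, rfl⟩, inferInstance,
    fg_epi_of_surjective _ hπ, fun g => ?_⟩
  let e := π.quotKerEquivOfSurjective hπ
  refine ⟨FGModuleCat.ofHom ((Submodule.liftQ _ g.hom.hom (h g.hom.hom)) ∘ₗ e.symm.toLinearMap), ?_⟩
  refine ObjectProperty.hom_ext _ (ModuleCat.hom_ext (LinearMap.ext fun x => ?_))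
  change g.hom.hom x = Submodule.liftQ _ g.hom.hom (h g.hom.hom) (e.symm (π x))
  rw [show e.symm (π x) = Submodule.Quotient.mk x from (LinearEquiv.symm_apply_eq e).2 rfl]
  rfl

variable [IsArtinianRing A]

lemma isUniversalTop_residue (I : Ideal A) (hI : I.IsMaximal) :
    IsUniversalTop (FGModuleCat.of A (A ⧸ I)) fun M => (Module.length A M).toNat where
  not_isZero h := by
    have : Subsingleton (A ⧸ I) := fg_subsingleton_of_isZero h
    exact hI.ne_top (Submodule.Quotient.subsingleton_iff.1 this)
  exists_shortExact M hM := by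
    have : Nontrivial M := not_subsingleton_iff_nontrivial.1 fun h =>
      hM (fg_isZero_of_subsingleton M)
    have : Nontrivial (A ⧸ I) := Submodule.Quotient.nontrivial_iff.2 hI.ne_top
    obtain ⟨f, hf⟩ := exists_surjective_quotient I hI M
    let p : M ⟶ FGModuleCat.of A (A ⧸ I) := FGModuleCat.ofHom f
    have : Epi p := fg_epi_of_surjective p hf
    have hp : (ShortComplex.mk (kernel.ι p) p (kernel.condition p)).ShortExact :=
      { exact := ShortComplex.exact_of_f_is_kernel _ (kernelIsKernel p) }
    refine ⟨kernel p, kernel.ι p, p, kernel.condition p, hp, ?_⟩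
    have hp' := hp.map_of_exact (forget₂ (FGModuleCat.{u} A) (ModuleCat.{u} A))
    have hlen : Module.length A M = Module.length A (kernel p : FGModuleCat A) +
        Module.length A (A ⧸ I) :=
      Module.length_eq_add_of_exact (kernel.ι p).hom.hom f hp'.moduleCat_injective_f hf
        ((ShortComplex.ShortExact.moduleCat_exact_iff_function_exact _).1 hp'.exact)
    have h₁ : Module.length A (kernel p : FGModuleCat A) ≠ ⊤ := Module.length_ne_top
    have h₂ : Module.length A (A ⧸ I) ≠ ⊤ := Module.length_ne_top
    have h₃ : 0 < Module.length A (A ⧸ I) := Module.length_pos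
    rw [hlen, ENat.toNat_add h₁ h₂]
    have : 0 < (Module.length A (A ⧸ I)).toNat := Nat.pos_of_ne_zero fun h => by
      rcases (ENat.toNat_eq_zero).1 h with h | h
      · exact h₃.ne' h
      · exact h₂ h
    lia

end FGModuleCat

end DerivedLocal

namespace DerivedLocal

open Pretriangulated DerivedCategory.TStructure

lemma exists_map_desc₃ {T₁ : Type u} [Category.{v} T₁] [Preadditive T₁] [HasZeroObject T₁]
    [HasShift T₁ ℤ] [∀ n : ℤ, (shiftFunctor T₁ n).Additive] [Pretriangulated T₁]
    {T₂ : Type w₁} [Category.{w₂} T₂] [Preadditive T₂] [HasZeroObject T₂]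
    [HasShift T₂ ℤ] [∀ n : ℤ, (shiftFunctor T₂ n).Additive] [Pretriangulated T₂]
    (G : T₁ ⥤ T₂) [G.CommShift ℤ] [G.IsTriangulated]
    {X Y Z W : T₁} {f : X ⟶ Y} {g : Y ⟶ Z} {h : Z ⟶ X⟦(1 : ℤ)⟧}
    (hT : Triangle.mk f g h ∈ distTriang T₁) (x : Z ⟶ W) (hx : G.map (g ≫ x) = 0) :
    ∃ y : G.obj (X⟦(1 : ℤ)⟧) ⟶ G.obj W, G.map x = G.map h ≫ y := by
  rw [Functor.map_comp] at hx
  obtain ⟨y, hy⟩ := Triangle.yoneda_exact₃ _ (G.map_distinguished _ hT) (G.map x) hx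
  exact ⟨(G.commShiftIso (1 : ℤ)).hom.app X ≫ y, hy.trans (Category.assoc _ _ _)⟩

section ExactFunctor

universe v₁ v₂ u₁ u₂

variable {C₁ : Type u₁} [Category.{v₁} C₁] [Abelian C₁] [HasDerivedCategory.{w₁} C₁]
  {C₂ : Type u₂} [Category.{v₂} C₂] [Abelian C₂] [HasDerivedCategory.{w₂} C₂]
  (F : C₁ ⥤ C₂) [F.Additive] [PreservesFiniteLimits F] [PreservesFiniteColimits F]

/-! ### Faithfulness of the functor induced by an exact inclusion -/

lemma mapDerivedCategory_single_eq_zero [F.Faithful] {M N : C₁} {n : ℤ}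
    (f : (DerivedCategory.singleFunctor C₁ n).obj M ⟶ (DerivedCategory.singleFunctor C₁ n).obj N)
    (hf : F.mapDerivedCategory.map f = 0) : f = 0 := by
  obtain ⟨g, rfl⟩ := (DerivedCategory.singleFunctor C₁ n).map_surjective f
  have h := (F.mapDerivedCategorySingleFunctor n).hom.naturality g
  rw [Functor.comp_map, hf, zero_comp, Functor.comp_map] at h
  have h' : (DerivedCategory.singleFunctor C₂ n).map (F.map g) = 0 := by
    rw [← cancel_epi ((F.mapDerivedCategorySingleFunctor n).hom.app M), ← h, comp_zero]
  rw [F.map_injective (((DerivedCategory.singleFunctor C₂ n).map_injective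
    (h'.trans (Functor.map_zero _ _ _).symm)).trans (F.map_zero _ _).symm), Functor.map_zero]

lemma mapDerivedCategory_single_surjective [F.Full] {M N : C₁} {n : ℤ}
    (f : F.mapDerivedCategory.obj ((DerivedCategory.singleFunctor C₁ n).obj M) ⟶
      F.mapDerivedCategory.obj ((DerivedCategory.singleFunctor C₁ n).obj N)) :
    ∃ g, F.mapDerivedCategory.map g = f := by
  let e := F.mapDerivedCategorySingleFunctor n
  obtain ⟨g, hg⟩ := (F ⋙ DerivedCategory.singleFunctor C₂ n).map_surjective
    (e.inv.app M ≫ f ≫ e.hom.app N)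
  refine ⟨(DerivedCategory.singleFunctor C₁ n).map g, ?_⟩
  have h := e.hom.naturality g
  rw [hg, Functor.comp_map] at h
  rw [← cancel_mono (e.hom.app N), h]
  simp

lemma mapDerivedCategory_projective_eq_zero [F.Faithful] {P M : C₁} [Projective P] {i n : ℤ}
    (f : (DerivedCategory.singleFunctor C₁ i).obj P ⟶ (DerivedCategory.singleFunctor C₁ n).obj M)
    (hf : F.mapDerivedCategory.map f = 0) : f = 0 := by
  by_cases h : n = i
  · subst h
    exact mapDerivedCategory_single_eq_zero F f hf
  · exact hom_single_projective_single_eq_zero h f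

variable [F.PreservesProjectiveObjects]

/-- Morphisms from stalk complexes of projectives to stalk complexes are not changed by `F`. -/
lemma mapDerivedCategory_projective_surjective [F.Full] {P M : C₁} [Projective P] {i n : ℤ}
    (f : F.mapDerivedCategory.obj ((DerivedCategory.singleFunctor C₁ i).obj P) ⟶
      F.mapDerivedCategory.obj ((DerivedCategory.singleFunctor C₁ n).obj M)) :
    ∃ g, F.mapDerivedCategory.map g = f := by
  by_cases h : n = i
  · subst h
    exact mapDerivedCategory_single_surjective F f
  · have : Projective (F.obj P) := F.projective_obj P
    refine ⟨0, ?_⟩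
    rw [Functor.map_zero, ← cancel_epi ((F.mapDerivedCategorySingleFunctor i).inv.app P),
      ← cancel_mono ((F.mapDerivedCategorySingleFunctor n).hom.app M), comp_zero, zero_comp]
    exact (hom_single_projective_single_eq_zero h _).symm

/-- `D(C₁) ⟶ D(C₂)` is faithful on morphisms from bounded above objects to stalk complexes. The
proof is a dimension shift: a projective cover of the top cohomology of `X` lowers the top degree,
until it falls below the degree of the stalk complex. -/
lemma mapDerivedCategory_eq_zero [F.Full] [F.Faithful] [EnoughProjectives C₁]
    (X : DerivedCategory C₁) (b n : ℤ) [X.IsLE b] {M : C₁} (f : X ⟶ (DerivedCategory.singleFunctor C₁ n).obj M)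
    (hf : F.mapDerivedCategory.map f = 0) : f = 0 := by
  obtain ⟨k, hk⟩ : ∃ k : ℕ, b < n + k := ⟨(b - n + 1).toNat, by lia⟩
  induction k generalizing X b with
  | zero => exact t.zero f b n (by lia)
  | succ k ih =>
    obtain ⟨X', N, i, p, δ, hT, h₁, -⟩ := exists_top_triangle X b
    obtain ⟨Z, q, r, ε, hZ, hZb, -⟩ := exists_projective_triangle hT h₁ (Projective.π N)
    have hqf : q ≫ f = 0 := mapDerivedCategory_projective_eq_zero F _ (by
      rw [Functor.map_comp, hf, comp_zero])
    obtain ⟨g, rfl⟩ := exists_desc₂ hZ f hqf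
    obtain ⟨y, hy⟩ := exists_map_desc₃ F.mapDerivedCategory hZ g hf
    -- Correct `g` by a map factoring through `P[1 - b]` so that it is killed by `F`.
    obtain ⟨x, hx⟩ := mapDerivedCategory_projective_surjective F (F.mapDerivedCategory.map
      (singleShiftIso (Projective.over N) 1 (b - 1) b (by lia)).inv ≫ y)
    set z := (singleShiftIso (Projective.over N) 1 (b - 1) b (by lia)).hom ≫ x with hz
    have hFz : F.mapDerivedCategory.map z = y := by
      rw [hz, Functor.map_comp, hx, ← Functor.map_comp_assoc, Iso.hom_inv_id,
        CategoryTheory.Functor.map_id, Category.id_comp]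
    have hg : g - ε ≫ z = 0 := by
      refine ih Z (b - 1) (g - ε ≫ z) ?_ (by push_cast at hk; lia)
      rw [Functor.map_sub, Functor.map_comp, hFz, sub_eq_zero, hy]
    rw [sub_eq_zero.1 hg, ← Category.assoc, distinguished_comp_eq_zero₂₃ hZ, zero_comp]

end ExactFunctor

end DerivedLocal

namespace DerivedLocal

open Pretriangulated DerivedCategory.TStructure

section KProjective

variable {C : Type u} [Category.{v} C] [Abelian C]

/-! ### K-projective models -/

lemma isKProjective_mappingCone {K L : CochainComplex C ℤ} [K.IsKProjective] [L.IsKProjective]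
    (f : K ⟶ L) : (CochainComplex.mappingCone f).IsKProjective := by
  rw [CochainComplex.isKProjective_iff_leftOrthogonal]
  exact ObjectProperty.ext_of_isTriangulatedClosed₃ _ _
    (HomotopyCategory.mappingCone_triangleh_distinguished f)
    (CochainComplex.IsKProjective.leftOrthogonal K)
    (CochainComplex.IsKProjective.leftOrthogonal L)

variable [HasDerivedCategory.{w} C]

lemma Q_map_surjective_of_isKProjective (K L : CochainComplex C ℤ) [K.IsKProjective]
    (f : DerivedCategory.Q.obj K ⟶ DerivedCategory.Q.obj L) :
    ∃ g : K ⟶ L, DerivedCategory.Q.map g = f := by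
  let e := DerivedCategory.quotientCompQhIso C
  obtain ⟨g, hg⟩ := (CochainComplex.IsKProjective.Qh_map_bijective K
    ((HomotopyCategory.quotient _ _).obj L)).surjective (e.hom.app K ≫ f ≫ e.inv.app L)
  obtain ⟨g, rfl⟩ := (HomotopyCategory.quotient _ _).map_surjective g
  refine ⟨g, ?_⟩
  rw [← cancel_epi (e.hom.app K), ← DerivedCategory.quotientCompQhIso_hom_naturality, hg,
    Category.assoc, Category.assoc, e.inv_hom_id_app, Category.comp_id]

lemma homotopy_zero_of_Q_map_eq_zero {K L : CochainComplex C ℤ} [K.IsKProjective] (f : K ⟶ L)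
    (hf : DerivedCategory.Q.map f = 0) : Nonempty (Homotopy f 0) := by
  refine ⟨HomotopyCategory.homotopyOfEq _ _ ?_⟩
  refine (CochainComplex.IsKProjective.Qh_map_bijective K
    ((HomotopyCategory.quotient _ _).obj L)).injective ?_
  rw [← cancel_mono ((DerivedCategory.quotientCompQhIso C).hom.app L),
    DerivedCategory.quotientCompQhIso_hom_naturality, hf, Functor.map_zero, Functor.map_zero,
    comp_zero, zero_comp]

lemma Q_map_eq_zero_of_homotopy {K L : CochainComplex C ℤ} (f : K ⟶ L) (h : Homotopy f 0) :
    DerivedCategory.Q.map f = 0 := by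
  rw [← cancel_epi ((DerivedCategory.quotientCompQhIso C).hom.app K),
    ← DerivedCategory.quotientCompQhIso_hom_naturality, HomotopyCategory.eq_of_homotopy f 0 h,
    Functor.map_zero, Functor.map_zero, comp_zero, zero_comp]

/-- `X` is isomorphic in the derived category to a K-projective complex. -/
def HasKProjectiveModel (X : DerivedCategory C) : Prop :=
  ∃ R : CochainComplex C ℤ, R.IsKProjective ∧ Nonempty (X ≅ DerivedCategory.Q.obj R)

lemma HasKProjectiveModel.of_iso {X Y : DerivedCategory C} (hX : HasKProjectiveModel X)
    (e : X ≅ Y) : HasKProjectiveModel Y := by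
  obtain ⟨R, hR, ⟨e'⟩⟩ := hX
  exact ⟨R, hR, ⟨e.symm ≪≫ e'⟩⟩

lemma HasKProjectiveModel.shift {X : DerivedCategory C} (hX : HasKProjectiveModel X) (n : ℤ) :
    HasKProjectiveModel (X⟦n⟧) := by
  obtain ⟨R, hR, ⟨e⟩⟩ := hX
  exact ⟨R⟦n⟧, inferInstance, ⟨(shiftFunctor _ n).mapIso e ≪≫
    (DerivedCategory.Q.commShiftIso n).symm.app R⟩⟩

lemma HasKProjectiveModel.ext₃ {T : Triangle (DerivedCategory C)} (hT : T ∈ distTriang _)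
    (h₁ : HasKProjectiveModel T.obj₁) (h₂ : HasKProjectiveModel T.obj₂) :
    HasKProjectiveModel T.obj₃ := by
  obtain ⟨R₁, hR₁, ⟨e₁⟩⟩ := h₁
  obtain ⟨R₂, hR₂, ⟨e₂⟩⟩ := h₂
  obtain ⟨φ, hφ⟩ := Q_map_surjective_of_isKProjective R₁ R₂ (e₁.inv ≫ T.mor₁ ≫ e₂.hom)
  have comm : T.mor₁ ≫ e₂.hom = e₁.hom ≫ DerivedCategory.Q.map φ := by
    rw [hφ, Iso.hom_inv_id_assoc]
  exact ⟨_, isKProjective_mappingCone φ, ⟨Triangle.π₃.mapIso (isoTriangleOfIso₁₂ T _ hT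
    (DerivedCategory.mappingCone_triangle_distinguished φ) e₁ e₂ comm)⟩⟩

lemma HasKProjectiveModel.ext₂ {T : Triangle (DerivedCategory C)} (hT : T ∈ distTriang _)
    (h₁ : HasKProjectiveModel T.obj₁) (h₃ : HasKProjectiveModel T.obj₃) :
    HasKProjectiveModel T.obj₂ := by
  have h := HasKProjectiveModel.ext₃ (rot_of_distTriang _ (rot_of_distTriang _ hT)) h₃
    (h₁.shift (1 : ℤ))
  exact (h.shift (-1 : ℤ)).of_iso ((shiftEquiv (DerivedCategory C) (1 : ℤ)).unitIso.symm.app _)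

lemma hasKProjectiveModel_single [EnoughProjectives C] (M : C) (n : ℤ) :
    HasKProjectiveModel ((DerivedCategory.singleFunctor C n).obj M) := by
  have h : HasKProjectiveModel ((DerivedCategory.singleFunctor C 0).obj M) :=
    ⟨(projectiveResolution M).cochainComplex, CochainComplex.isKProjective_of_projective _ 0,
      ⟨(asIso (DerivedCategory.Q.map (projectiveResolution M).π')).symm⟩⟩
  exact (h.shift (-n)).of_iso (singleShiftIso M (-n) n 0 (by lia))

open scoped ZeroObject in
lemma hasKProjectiveModel_of_bounded [EnoughProjectives C] (X : DerivedCategory C) (a b : ℤ)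
    [X.IsGE a] [X.IsLE b] : HasKProjectiveModel X := by
  refine bounded_induction (fun X _ => HasKProjectiveModel X) (fun X _ hX => ?_) ?_ X a b
  · exact (hasKProjectiveModel_single (0 : C) 0).of_iso
      (((DerivedCategory.singleFunctor C 0).map_isZero (isZero_zero C)).iso hX)
  · intro X' X M b i q δ hT hX'
    exact HasKProjectiveModel.ext₂ hT hX' (hasKProjectiveModel_single M b)

end KProjective

section Coproduct

variable {C : Type u} [Category.{v} C] [Abelian C]

/-! ### Coproducts of K-projective complexes -/

variable {J : Type w₁} [HasCoproductsOfShape J C] (K : J → CochainComplex C ℤ)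

/-- Each degree of the coproduct of a family of complexes is a coproduct. -/
noncomputable def isColimitSigmaX (n : ℤ) :
    IsColimit (Cofan.mk ((∐ K).X n) fun j => (Sigma.ι K j).f n) :=
  isColimitCofanMkObjOfIsColimit (HomologicalComplex.eval C (ComplexShape.up ℤ) n) K _
    (coproductIsCoproduct K)

variable {K}

/-- Null-homotopies on the summands assemble to a null-homotopy on the coproduct. -/
lemma homotopy_sigma {L : CochainComplex C ℤ} (f : ∐ K ⟶ L)
    (h : ∀ j, Nonempty (Homotopy (Sigma.ι K j ≫ f) 0)) : Nonempty (Homotopy f 0) := by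
  let h' : ∀ j, Homotopy (Sigma.ι K j ≫ f) 0 := fun j => (h j).some
  let H (p q : ℤ) : (∐ K).X p ⟶ L.X q :=
    Cofan.IsColimit.desc (isColimitSigmaX K p) fun j => (h' j).hom p q
  have hH (j : J) (p q : ℤ) : (Sigma.ι K j).f p ≫ H p q = (h' j).hom p q :=
    Cofan.IsColimit.fac (isColimitSigmaX K p) _ j
  have hH' (j : J) : (fun p q => (Sigma.ι K j).f p ≫ H p q) = (h' j).hom := by
    funext p q
    exact hH j p q
  refine ⟨⟨H, fun p q hpq => ?_, fun p => ?_⟩⟩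
  · refine Cofan.IsColimit.hom_ext (isColimitSigmaX K p) _ _ fun j => ?_
    exact (hH j p q).trans (((h' j).zero p q hpq).trans comp_zero.symm)
  · refine Cofan.IsColimit.hom_ext (isColimitSigmaX K p) _ _ fun j => ?_
    have := (h' j).comm p
    rw [← hH', dNext_comp_left, prevD_comp_left, HomologicalComplex.comp_f,
      HomologicalComplex.zero_f, add_zero] at this
    rw [HomologicalComplex.zero_f, add_zero]
    exact this.trans (Preadditive.comp_add _ _ _ _ _ _).symm

lemma isKProjective_sigma (hK : ∀ j, (K j).IsKProjective) : (∐ K).IsKProjective where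
  nonempty_homotopy_zero f hL := homotopy_sigma f fun j => (hK j).nonempty_homotopy_zero _ hL

variable [HasDerivedCategory.{w} C]

/-- The localization functor to the derived category preserves coproducts of K-projective
complexes. -/
lemma isColimit_Q_sigma (hK : ∀ j, (K j).IsKProjective) :
    Nonempty (IsColimit (Cofan.mk (f := fun j => DerivedCategory.Q.obj (K j))
      (DerivedCategory.Q.obj (∐ K)) fun j => DerivedCategory.Q.map (Sigma.ι K j))) := by
  have := isKProjective_sigma hK
  have hext (Z : DerivedCategory C) (f g : DerivedCategory.Q.obj (∐ K) ⟶ Z)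
      (h : ∀ j, DerivedCategory.Q.map (Sigma.ι K j) ≫ f = DerivedCategory.Q.map (Sigma.ι K j) ≫ g) :
      f = g := by
    let e := DerivedCategory.Q.objObjPreimageIso Z
    obtain ⟨x, hx⟩ := Q_map_surjective_of_isKProjective _ _ ((f - g) ≫ e.inv)
    have : DerivedCategory.Q.map x = 0 := by
      obtain ⟨h⟩ := homotopy_sigma x fun j => homotopy_zero_of_Q_map_eq_zero _ (by
        rw [Functor.map_comp, hx, ← Category.assoc, Preadditive.comp_sub, h, sub_self, zero_comp])
      exact Q_map_eq_zero_of_homotopy x h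
    rw [this, eq_comm, ← zero_comp (f := e.inv), cancel_mono] at hx
    exact sub_eq_zero.1 hx
  have hdesc (Z : DerivedCategory C) (f : ∀ j, DerivedCategory.Q.obj (K j) ⟶ Z) :
      ∃ g : DerivedCategory.Q.obj (∐ K) ⟶ Z, ∀ j, DerivedCategory.Q.map (Sigma.ι K j) ≫ g = f j := by
    let e := DerivedCategory.Q.objObjPreimageIso Z
    choose x hx using fun j => Q_map_surjective_of_isKProjective _ _ (f j ≫ e.inv)
    refine ⟨DerivedCategory.Q.map (Sigma.desc x) ≫ e.hom, fun j => ?_⟩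
    rw [← Category.assoc, ← Functor.map_comp, Sigma.ι_desc, hx, Category.assoc, e.inv_hom_id,
      Category.comp_id]
  exact ⟨Cofan.IsColimit.mk _ (fun s => (hdesc s.pt s.inj).choose)
    (fun s j => (hdesc s.pt s.inj).choose_spec j)
    fun s m hm => hext _ _ _ fun j => (hm j).trans ((hdesc s.pt s.inj).choose_spec j).symm⟩

end Coproduct

section LocallyFinite

variable {C : Type u} [Category.{v} C] [Abelian C] [HasCoproductsOfShape (ULift.{w₁} ℕ) C]
  {K : ULift.{w₁} ℕ → CochainComplex C ℤ} {R : CochainComplex C ℤ} (φ : ∀ j, R ⟶ K j)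

/-! ### Locally finite families of complexes -/

/-- Partial sums of the maps `φ j` in a fixed degree; they become stationary, because only
finitely many `K j` are nonzero in a given degree. -/
noncomputable def partialSum (n : ℤ) (N : ℕ) : R.X n ⟶ (∐ K).X n :=
  ∑ j ∈ Finset.range N, (φ ⟨j⟩).f n ≫ (Sigma.ι K ⟨j⟩).f n

lemma partialSum_eq (hK : ∀ j, (K j).IsStrictlyLE (-(j.down : ℤ))) (n : ℤ) {N N' : ℕ}
    (hN : -n < N) (h : N ≤ N') :
    partialSum φ n N' = partialSum φ n N := by
  refine (Finset.sum_subset (Finset.range_mono h) fun j _ hj => ?_).symm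
  have := hK ⟨j⟩
  rw [Finset.mem_range] at hj
  have h0 : (φ ⟨j⟩).f n = 0 :=
    ((K ⟨j⟩).isZero_of_isStrictlyLE (-(j : ℤ)) n (by lia)).eq_of_tgt _ _
  rw [h0, zero_comp]

/-- A family of maps `R ⟶ K j` into a locally finite family of complexes is the family of
components of a map into the coproduct. -/
lemma exists_lift_sigma (hK : ∀ j, (K j).IsStrictlyLE (-(j.down : ℤ))) :
    ∃ f : R ⟶ ∐ K, ∀ j, f ≫ Sigma.π K j = φ j := by
  have hlt (n : ℤ) : -n < ((-n).toNat + 1 : ℕ) := by lia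
  refine ⟨{ f := fun n => partialSum φ n ((-n).toNat + 1), comm' := ?_ }, fun j => ?_⟩
  · rintro n m rfl
    rw [← partialSum_eq φ hK (n + 1) (hlt (n + 1))
      (show (-(n + 1)).toNat + 1 ≤ (-n).toNat + 1 by lia)]
    simp only [partialSum, Preadditive.sum_comp, Preadditive.comp_sum, Category.assoc,
      HomologicalComplex.Hom.comm, HomologicalComplex.Hom.comm_assoc]
  · ext n
    change partialSum φ n ((-n).toNat + 1) ≫ (Sigma.π K j).f n = _
    rw [← partialSum_eq φ hK n (hlt n) (Nat.le_add_right _ (j.down + 1)), partialSum,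
      Preadditive.sum_comp, Finset.sum_eq_single j.down]
    · rw [Category.assoc, ← HomologicalComplex.comp_f]
      simp
    · intro i _ hi
      rw [Category.assoc, ← HomologicalComplex.comp_f,
        Sigma.ι_π_of_ne _ fun h => hi (congrArg ULift.down h), HomologicalComplex.zero_f, comp_zero]
    · intro h
      exact absurd (Finset.mem_range.2 (by lia)) h

end LocallyFinite

section Compact

/-! ### Compact objects -/

/-- A morphism from a compact object to a coproduct has only finitely many nonzero components. -/
lemma IsCompactObject.finite_support {T : Type u} [Category.{v} T] [Preadditive T] {X : T}
    (hX : IsCompactObject.{v, u, w} X) {J : Type w} {Y : J → T} {Z : T} (ι : ∀ j, Y j ⟶ Z)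
    (hZ : IsColimit (Cofan.mk Z ι)) (p : ∀ j, Z ⟶ Y j) (hp : ∀ i j, i ≠ j → ι i ≫ p j = 0)
    (f : X ⟶ Z) : {j | f ≫ p j ≠ 0}.Finite := by
  have := hX J
  let G := preadditiveCoyoneda.obj (Opposite.op X)
  have hG : IsColimit (Cofan.mk (G.obj Z) fun j => G.map (ι j)) :=
    isColimitCofanMkObjOfIsColimit G Y ι hZ
  let H : AddSubgroup (X ⟶ Z) :=
    { carrier := {f | {j | f ≫ p j ≠ 0}.Finite}
      zero_mem' := by simp
      add_mem' := fun {a b} ha hb => (ha.union hb).subset fun j hj => by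
        by_contra h
        simp only [Set.mem_union, Set.mem_ofPred_eq, not_or, not_not] at h
        exact hj (by rw [Preadditive.add_comp, h.1, h.2, add_zero])
      neg_mem' := fun {a} ha => by simpa using ha }
  have hH (i : J) (g : X ⟶ Y i) : g ≫ ι i ∈ H := by
    refine (Set.finite_singleton i).subset fun j hj => ?_
    by_contra h
    exact hj (by rw [Category.assoc, hp i j (Ne.symm h), comp_zero])
  -- The quotient map by `H` vanishes on the summands, hence everywhere.
  have hq : (AddCommGrpCat.ofHom (QuotientAddGroup.mk' H) :
      G.obj Z ⟶ AddCommGrpCat.of ((X ⟶ Z) ⧸ H)) = 0 := by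
    refine Cofan.IsColimit.hom_ext hG _ _ fun i => ?_
    ext g
    exact (QuotientAddGroup.eq_zero_iff _).2 (hH i g)
  have : QuotientAddGroup.mk' H f = 0 := congrArg (fun q => q.hom f) hq
  exact (QuotientAddGroup.eq_zero_iff _).1 this

end Compact

end DerivedLocal

namespace DerivedLocal

open Pretriangulated DerivedCategory.TStructure

section Bound

variable {C : Type u} [Category.{v} C] [Abelian C] [HasDerivedCategory.{w} C]
  [EnoughProjectives C]

/-! ### Morphisms from compact objects to stalk complexes -/

/-- A bounded compact object has only finitely many nonzero cohomology groups with values in `S`: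
otherwise nonzero classes in infinitely many degrees are the components of a morphism into the
coproduct of the shifts of a projective resolution of `S`. -/
lemma IsCompactObject.exists_hom_single_eq_zero [HasCoproductsOfShape (ULift.{w₁} ℕ) C]
    {Y : DerivedCategory C} (hY : IsCompactObject.{w, max u v, w₁} Y) (a b : ℤ)
    [Y.IsGE a] [Y.IsLE b] (S : C) :
    ∃ N : ℤ, ∀ m < N, ∀ f : Y ⟶ (DerivedCategory.singleFunctor C m).obj S, f = 0 := by
  classical
  let P := (projectiveResolution S).cochainComplex
  let K : ULift.{w₁} ℕ → CochainComplex C ℤ := fun j => P⟦(j.down : ℤ)⟧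
  have hK (j) : (K j).IsStrictlyLE (-(j.down : ℤ)) := P.isStrictlyLE_shift 0 _ _ (by lia)
  have hK' (j) : (K j).IsKProjective := inferInstanceAs (P⟦(j.down : ℤ)⟧).IsKProjective
  let e (j : ULift.{w₁} ℕ) : DerivedCategory.Q.obj (K j) ≅
      (DerivedCategory.singleFunctor C (-(j.down : ℤ))).obj S :=
    (DerivedCategory.Q.commShiftIso (j.down : ℤ)).app P ≪≫ (shiftFunctor _ (j.down : ℤ)).mapIso
      (asIso (DerivedCategory.Q.map (projectiveResolution S).π')) ≪≫
      singleShiftIso S (j.down : ℤ) (-(j.down : ℤ)) 0 (by lia)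
  obtain ⟨R, hR, ⟨i⟩⟩ := hasKProjectiveModel_of_bounded Y a b
  have hf (j : ULift.{w₁} ℕ) : ∃ f : Y ⟶ (DerivedCategory.singleFunctor C (-(j.down : ℤ))).obj S,
      f = 0 → ∀ g : Y ⟶ (DerivedCategory.singleFunctor C (-(j.down : ℤ))).obj S, g = 0 := by
    by_contra! h
    obtain ⟨h₁, g, hg⟩ := h 0
    exact hg (h g).1
  choose f hf using hf
  choose φ hφ using fun j => Q_map_surjective_of_isKProjective R (K j) (i.inv ≫ f j ≫ (e j).inv)
  obtain ⟨x, hx⟩ := exists_lift_sigma φ hK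
  obtain ⟨hc⟩ := isColimit_Q_sigma hK'
  have hfin := hY.finite_support _ hc (fun j => DerivedCategory.Q.map (Sigma.π K j))
    (fun j j' hj => by
      rw [← Functor.map_comp, Sigma.ι_π_of_ne _ hj, Functor.map_zero])
    (i.hom ≫ DerivedCategory.Q.map x)
  obtain ⟨B, hB⟩ := (hfin.image ULift.down).bddAbove
  refine ⟨-B, fun m hm => ?_⟩
  obtain ⟨j, rfl⟩ : ∃ j : ℕ, m = -j := ⟨(-m).toNat, by lia⟩
  refine hf ⟨j⟩ ?_
  have h0 : (i.hom ≫ DerivedCategory.Q.map x) ≫ DerivedCategory.Q.map (Sigma.π K ⟨j⟩) = 0 := by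
    by_contra h
    have := hB ⟨_, h, rfl⟩
    dsimp only at this
    lia
  rw [Category.assoc, ← Functor.map_comp, hx, hφ, Iso.hom_inv_id_assoc] at h0
  rw [← cancel_mono (e ⟨j⟩).inv, h0, zero_comp]

end Bound

section ExactFunctor

universe v₁ v₂ u₁ u₂

variable {C₁ : Type u₁} [Category.{v₁} C₁] [Abelian C₁] [HasDerivedCategory.{w₁} C₁]
  {C₂ : Type u₂} [Category.{v₂} C₂] [Abelian C₂] [HasDerivedCategory.{w₂} C₂]
  (F : C₁ ⥤ C₂) [F.Additive] [PreservesFiniteLimits F] [PreservesFiniteColimits F]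

lemma mapDerivedCategory_isGE_isLE (X : DerivedCategory C₁) (a b : ℤ) [X.IsGE a] [X.IsLE b] :
    (F.mapDerivedCategory.obj X).IsGE a ∧ (F.mapDerivedCategory.obj X).IsLE b := by
  obtain ⟨K, _, _, ⟨e⟩⟩ := X.exists_iso_Q_obj_of_isGE_of_isLE a b
  let L := (F.mapHomologicalComplex (ComplexShape.up ℤ)).obj K
  have : CochainComplex.IsStrictlyGE L a := HomologicalComplex.map_isStrictlySupported ..
  have : CochainComplex.IsStrictlyLE L b := HomologicalComplex.map_isStrictlySupported ..
  let e' : F.mapDerivedCategory.obj X ≅ DerivedCategory.Q.obj L :=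
    F.mapDerivedCategory.mapIso e ≪≫ F.mapDerivedCategoryFactors.app K
  have : (DerivedCategory.Q.obj L).IsGE a := inferInstance
  have : (DerivedCategory.Q.obj L).IsLE b := inferInstance
  exact ⟨t.isGE_of_iso e'.symm a, t.isLE_of_iso e'.symm b⟩

end ExactFunctor

section FGModuleCat

variable {A : Type u} [Ring A] [IsNoetherianRing A]

lemma exists_fg_free_cover (M : FGModuleCat.{u} A) :
    ∃ (n : ℕ) (π : FGModuleCat.of A (Fin n → A) ⟶ M), Epi π := by
  obtain ⟨n, f, hf⟩ := Module.Finite.exists_fin' A M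
  exact ⟨n, FGModuleCat.ofHom f, fg_epi_of_surjective _ hf⟩

instance fg_enoughProjectives : EnoughProjectives (FGModuleCat.{u} A) where
  presentation M := by
    obtain ⟨n, π, hπ⟩ := exists_fg_free_cover M
    exact ⟨{ p := FGModuleCat.of A (Fin n → A), f := π }⟩

instance forget₂_preservesProjectiveObjects :
    (forget₂ (FGModuleCat.{u} A) (ModuleCat.{u} A)).PreservesProjectiveObjects where
  projective_obj {P} hP := by
    obtain ⟨n, π, hπ⟩ := exists_fg_free_cover P
    have r : Retract P (FGModuleCat.of A (Fin n → A)) :=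
      { i := Projective.factorThru (𝟙 P) π
        r := π
        retract := Projective.factorThru_comp _ _ }
    have : Projective ((forget₂ (FGModuleCat.{u} A) (ModuleCat.{u} A)).obj
        (FGModuleCat.of A (Fin n → A))) :=
      inferInstanceAs (Projective (ModuleCat.of A (Fin n → A)))
    exact (r.map (forget₂ (FGModuleCat.{u} A) (ModuleCat.{u} A))).projective

variable [HasDerivedCategory.{w₁} (FGModuleCat.{u} A)] [HasDerivedCategory.{w₂} (ModuleCat.{u} A)]

lemma IsCompact.exists_hom_single_eq_zero {X : Db A} (hX : IsCompact.{u, w₁, w₂} X)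
    (S : FGModuleCat.{u} A) :
    ∃ N : ℤ, ∀ m < N,
      ∀ f : X.obj ⟶ (DerivedCategory.singleFunctor (FGModuleCat.{u} A) m).obj S, f = 0 := by
  let F := forget₂ (FGModuleCat.{u} A) (ModuleCat.{u} A)
  obtain ⟨⟨a, ha⟩, ⟨b, hb⟩⟩ := X.property
  have : X.obj.IsGE a := ha
  have : X.obj.IsLE b := hb
  obtain ⟨_, _⟩ := mapDerivedCategory_isGE_isLE F X.obj a b
  obtain ⟨N, hN⟩ := IsCompactObject.exists_hom_single_eq_zero.{u, u + 1, w₂, u}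
    (Y := F.mapDerivedCategory.obj X.obj) hX a b (F.obj S)
  refine ⟨N, fun m hm f => mapDerivedCategory_eq_zero F X.obj b m f ?_⟩
  rw [← cancel_mono ((F.mapDerivedCategorySingleFunctor m).hom.app S), zero_comp]
  exact hN m hm _

end FGModuleCat

end DerivedLocal

namespace DerivedLocal

open Pretriangulated DerivedCategory.TStructure

section Exceptional

variable {T₁ : Type u} [Category.{v} T₁] [Preadditive T₁] [HasShift T₁ ℤ]
  {T₂ : Type w₁} [Category.{w₂} T₂] [Preadditive T₂] [HasShift T₂ ℤ]

/-! ### Exceptional objects -/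

lemma IsExceptional.of_iso {X Y : T₁} (hX : IsExceptional X) (e : X ≅ Y) : IsExceptional Y := by
  intro n hn f
  have h := hX n hn (e.hom ≫ f ≫ e.inv⟦n⟧')
  rw [← cancel_epi e.hom, ← cancel_mono (e.inv⟦n⟧'), Category.assoc, h, comp_zero, zero_comp]

variable (G : T₁ ⥤ T₂) [G.CommShift ℤ] [G.Additive]

lemma IsExceptional.map [G.Full] {X : T₁} (hX : IsExceptional X) : IsExceptional (G.obj X) := by
  intro n hn f
  obtain ⟨g, hg⟩ := G.map_surjective (f ≫ (G.commShiftIso n).inv.app X)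
  rw [hX n hn g, Functor.map_zero] at hg
  rw [← cancel_mono ((G.commShiftIso n).inv.app X), ← hg, zero_comp]

lemma IsExceptional.of_map [G.Faithful] {X : T₁} (hX : IsExceptional (G.obj X)) :
    IsExceptional X := by
  intro n hn f
  have h := hX n hn (G.map f ≫ (G.commShiftIso n).hom.app X)
  exact G.map_injective ((cancel_mono ((G.commShiftIso n).hom.app X)).1
    (by rw [h, Functor.map_zero, zero_comp]))

end Exceptional

section Bounded

variable (A : Type u) [Ring A] [IsNoetherianRing A] [HasDerivedCategory.{w₁} (FGModuleCat.{u} A)]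

/-! ### Stalk complexes in the bounded derived category -/

/-- The functor sending a finitely generated module to the stalk complex in degree `n`, as an
object of `D^b(A)`. -/
noncomputable def boundedSingle (n : ℤ) : FGModuleCat.{u} A ⥤ Db A :=
  ObjectProperty.lift _ (DerivedCategory.singleFunctor (FGModuleCat.{u} A) n) fun _ =>
    ⟨⟨n, inferInstance⟩, ⟨n, inferInstance⟩⟩

instance (n : ℤ) : (boundedSingle A n).Full where
  map_surjective {M N} f := by
    obtain ⟨g, hg⟩ := (DerivedCategory.singleFunctor (FGModuleCat.{u} A) n).map_surjective f.hom
    exact ⟨g, ObjectProperty.hom_ext _ hg⟩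

instance (n : ℤ) : (boundedSingle A n).Faithful where
  map_injective h := (DerivedCategory.singleFunctor (FGModuleCat.{u} A) n).map_injective
    (congrArg (fun f => f.hom) h)

instance (n : ℤ) : (boundedSingle A n).Additive where
  map_add := ObjectProperty.hom_ext _
    ((DerivedCategory.singleFunctor (FGModuleCat.{u} A) n).map_add)

instance {R : Type v} [CommRing R] [Algebra R A] (n : ℤ) : (boundedSingle A n).Linear R where
  map_smul f r := ObjectProperty.hom_ext _
    ((DerivedCategory.singleFunctor (FGModuleCat.{u} A) n).map_smul r f)

variable {A}

lemma isZero_of_boundedSingle {n : ℤ} {M : FGModuleCat.{u} A}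
    (h : IsZero ((boundedSingle A n).obj M)) : IsZero M := by
  rw [IsZero.iff_id_eq_zero]
  exact (boundedSingle A n).map_injective (h.eq_of_src _ _)

/-- The stalk complex in degree `m` is the shift of the stalk complex in degree `b`. -/
noncomputable def boundedSingleShiftIso (M : FGModuleCat.{u} A) (a m b : ℤ) (h : a + m = b) :
    ((boundedSingle A b).obj M)⟦a⟧ ≅ (boundedSingle A m).obj M :=
  (DerivedCategory.Bounded.ι (C := FGModuleCat.{u} A)).preimageIso
    ((DerivedCategory.Bounded.ι.commShiftIso a).app _ ≪≫ singleShiftIso M a m b h)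

lemma isExceptional_stalk : IsExceptional (stalk A) := by
  refine IsExceptional.of_map DerivedCategory.Bounded.ι fun n hn f => ?_
  change (DerivedCategory.singleFunctor (FGModuleCat.{u} A) 0).obj (FGModuleCat.of A A) ⟶
    ((DerivedCategory.singleFunctor (FGModuleCat.{u} A) 0).obj (FGModuleCat.of A A))⟦n⟧ at f
  change f = 0
  rw [← cancel_mono (singleShiftIso (FGModuleCat.of A A) n (-n) 0 (by lia)).hom, zero_comp]
  exact hom_single_projective_single_eq_zero (by lia) _

lemma exists_hom_stalk_shift_eq_zero (Y : Db A) :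
    ∃ N : ℤ, ∀ n > N, ∀ f : stalk A ⟶ Y⟦n⟧, f = 0 := by
  obtain ⟨-, ⟨b, hb⟩⟩ := Y.property
  have : Y.obj.IsLE b := hb
  refine ⟨b, fun n hn f => ?_⟩
  have : (Y.obj⟦n⟧).IsLE (b - n) := t.isLE_shift Y.obj b n (b - n)
  refine DerivedCategory.Bounded.ι.map_injective ?_
  rw [← cancel_mono ((DerivedCategory.Bounded.ι.commShiftIso n).hom.app Y), Functor.map_zero,
    zero_comp]
  exact hom_single_projective_eq_zero (P := FGModuleCat.of A A) (Y := Y.obj⟦n⟧) (n := b - n)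
    (i := 0) (by lia) _

lemma isZero_of_subsingleton [Subsingleton A] (X : Db A) : IsZero X := by
  have hM (M : FGModuleCat.{u} A) : IsZero M :=
    have := Module.subsingleton A M
    fg_isZero_of_subsingleton M
  have hK (K : CochainComplex (FGModuleCat.{u} A) ℤ) : IsZero K := by
    rw [IsZero.iff_id_eq_zero]
    ext n : 1
    exact (hM _).eq_of_src _ _
  have h : IsZero X.obj := (DerivedCategory.Q.map_isZero (hK _)).of_iso
    (DerivedCategory.Q.objObjPreimageIso X.obj).symm
  rw [IsZero.iff_id_eq_zero]
  exact ObjectProperty.hom_ext _ (h.eq_of_src _ _)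

section LocalRing

variable [IsLocalRing A] [IsArtinianRing A]

/-- Over a local ring, a nonzero exceptional object is a shift of a free module as soon as it has no
morphisms to the residue module placed in very negative degrees. -/
lemma exists_iso_boundedSingle (I : Ideal A) (hI : I.IsMaximal) {X : Db A} (hX₀ : ¬IsZero X)
    (hX : IsExceptional X) {N : ℤ} (hN : ∀ m < N, ∀ f : X.obj ⟶
      (DerivedCategory.singleFunctor (FGModuleCat.{u} A) m).obj (FGModuleCat.of A (A ⧸ I)), f = 0) :
    ∃ (b : ℤ) (n : ℕ), Nonempty (X ≅ (boundedSingle A b).obj (FGModuleCat.of A (Fin n → A))) := by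
  obtain ⟨⟨a, ha⟩, ⟨b', hb'⟩⟩ := X.property
  have : X.obj.IsGE a := ha
  have : X.obj.IsLE b' := hb'
  have hX₀' : ¬IsZero X.obj := fun h => hX₀ (by
    rw [IsZero.iff_id_eq_zero]
    exact ObjectProperty.hom_ext _ (h.eq_of_src _ _))
  obtain ⟨b, hb, hb₁⟩ := exists_isLE_not_isLE X.obj hX₀' a b'
  have hX' : IsExceptional X.obj := hX.map DerivedCategory.Bounded.ι
  have hS := isUniversalTop_residue I hI
  obtain ⟨P, ⟨n, rfl⟩, ⟨e⟩⟩ := hS.exists_iso_single (X := X.obj) (a := a) (b := b)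
    (fun m hm f => hS.hom_eq_zero_of_exceptional (a := a) (b := b) hb₁ hN hX' hm f)
    (fun P => ∃ n : ℕ, P = FGModuleCat.of A (Fin n → A)) (exists_projective_cover I hI)
  exact ⟨b, n, ⟨DerivedCategory.Bounded.ι.preimageIso e⟩⟩

end LocalRing

end Bounded

end DerivedLocal

namespace DerivedLocal

section Indecomposable

variable {A : Type u} [Ring A] [IsNoetherianRing A] [HasDerivedCategory.{w₁} (FGModuleCat.{u} A)]

/-! ### Indecomposable free stalk complexes -/

/-- The decomposition `A ^ (m + 1) = A ⊕ A ^ m` of finitely generated modules. -/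
noncomputable def freeSuccIso (m : ℕ) : FGModuleCat.of A (Fin (m + 1) → A) ≅
    FGModuleCat.of A A ⊞ FGModuleCat.of A (Fin m → A) :=
  let e : (A × (Fin m → A)) ≃ₗ[A] (Fin (m + 1) → A) := Fin.consLinearEquiv A fun _ => A
  have hom_ext {M N : FGModuleCat.{u} A} {f g : M ⟶ N} (h : ∀ x, f.hom.hom x = g.hom.hom x) :
      f = g := ObjectProperty.hom_ext _ (ModuleCat.hom_ext (LinearMap.ext h))
  biprod.uniqueUpToIso (FGModuleCat.of A A) (FGModuleCat.of A (Fin m → A))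
    (b :=
      { pt := FGModuleCat.of A (Fin (m + 1) → A)
        fst := FGModuleCat.ofHom (LinearMap.fst A A _ ∘ₗ e.symm.toLinearMap)
        snd := FGModuleCat.ofHom (LinearMap.snd A A _ ∘ₗ e.symm.toLinearMap)
        inl := FGModuleCat.ofHom (e.toLinearMap ∘ₗ LinearMap.inl A A _)
        inr := FGModuleCat.ofHom (e.toLinearMap ∘ₗ LinearMap.inr A A _)
        inl_fst := hom_ext fun x => congrArg Prod.fst (e.symm_apply_apply (x, 0))
        inl_snd := hom_ext fun x => congrArg Prod.snd (e.symm_apply_apply (x, 0))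
        inr_fst := hom_ext fun x => congrArg Prod.fst (e.symm_apply_apply (0, x))
        inr_snd := hom_ext fun x => congrArg Prod.snd (e.symm_apply_apply (0, x)) })
    (isBinaryBilimitOfTotal _ (hom_ext fun x => by
      change e ((e.symm x).1, 0) + e (0, (e.symm x).2) = x
      rw [← map_add, Prod.mk_add_mk, add_zero, zero_add, Prod.mk.eta, e.apply_symm_apply]))

lemma eq_one_of_indecomposable [Nontrivial A] {X : Db A} (hX : Indecomposable X) {b : ℤ} {n : ℕ}
    (e : X ≅ (boundedSingle A b).obj (FGModuleCat.of A (Fin n → A))) : n = 1 := by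
  obtain _ | m := n
  · exact absurd (((boundedSingle A b).map_isZero (fg_isZero_of_subsingleton _)).of_iso e) hX.1
  · have := preservesBinaryBiproducts_of_preservesBiproducts (boundedSingle A b)
    rcases hX.2 _ _ (e ≪≫ (boundedSingle A b).mapIso (freeSuccIso m) ≪≫
      (boundedSingle A b).mapBiprod _ _) with h | h
    · exact absurd (fg_subsingleton_of_isZero (isZero_of_boundedSingle h))
        (not_subsingleton A)
    · have : Subsingleton (Fin m → A) := fg_subsingleton_of_isZero (isZero_of_boundedSingle h)
      obtain _ | m := m
      · rfl
      · exact absurd this (not_subsingleton _)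

end Indecomposable

section End

variable (R : Type v) [CommRing R]

/-! ### Endomorphism algebras -/

section

variable {T₁ : Type u} [Category.{w} T₁] [Preadditive T₁] [CategoryTheory.Linear R T₁]
  {T₂ : Type w₁} [Category.{w₂} T₂] [Preadditive T₂] [CategoryTheory.Linear R T₂]

/-- Isomorphic objects have isomorphic endomorphism algebras. -/
noncomputable def isoEndAlgEquiv {X Y : T₁} (e : X ≅ Y) : End X ≃ₐ[R] End Y :=
  { e.conj with
    map_add' := fun f g => by
      change e.inv ≫ ((f : X ⟶ X) + g) ≫ e.hom = e.inv ≫ f ≫ e.hom + e.inv ≫ g ≫ e.hom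
      rw [Preadditive.add_comp, Preadditive.comp_add]
    commutes' := fun r => by
      change e.conj (r • 𝟙 X) = r • 𝟙 Y
      simp [Iso.conj_apply] }

/-- A fully faithful linear functor preserves endomorphism algebras. -/
noncomputable def mapEndAlgEquiv (G : T₁ ⥤ T₂) [G.Full] [G.Faithful] [G.Additive] [G.Linear R]
    (X : T₁) : End X ≃ₐ[R] End (G.obj X) :=
  { (Functor.FullyFaithful.ofFullyFaithful G).mulEquivEnd X with
    map_add' := fun f g => G.map_add
    commutes' := fun r => by
      change G.map (r • 𝟙 X) = r • 𝟙 _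
      rw [Functor.map_smul, CategoryTheory.Functor.map_id] }

/-- Additive functors are `ℤ`-linear for all `ℤ`-linear structures, not just for those given by the
`ℤ`-module structure of an additive group. -/
lemma linear_int {_ : CategoryTheory.Linear ℤ T₁} {_ : CategoryTheory.Linear ℤ T₂} (G : T₁ ⥤ T₂)
    [G.Additive] : G.Linear ℤ where
  map_smul f r := by
    have h := map_zsmul (G.mapAddHom (X := _) (Y := _)) r f
    exact (congrArg G.map (int_smul_eq_zsmul _ r f)).trans
      (h.trans (int_smul_eq_zsmul _ r (G.map f)).symm)

end

variable {A : Type u} [Ring A] [Algebra R A]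

/-- The categorical endomorphism algebra of a finitely generated module. -/
def fgEndAlgEquiv (M : Type u) [AddCommGroup M] [Module A M] [Module.Finite A M] [Module R M]
    [IsScalarTower R A M] : End (FGModuleCat.of A M) ≃ₐ[R] Module.End A M where
  toFun f := f.hom.hom
  invFun f := FGModuleCat.ofHom f
  left_inv _ := rfl
  right_inv _ := rfl
  map_mul' _ _ := rfl
  map_add' _ _ := rfl
  commutes' r := by
    ext x
    exact algebraMap_smul A r x

/-- The endomorphism algebra of a free module of finite rank. -/
def endFreeAlgEquiv (n : ℕ) : Module.End A (Fin n → A) ≃ₐ[R] (Matrix (Fin n) (Fin n) A)ᵐᵒᵖ :=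
  ((endVecAlgEquivMatrixEnd (Fin n) R A A).trans
    (AlgEquiv.moduleEndSelf R (A := A)).symm.mapMatrix).trans AlgEquiv.mopMatrix

end End

section Equivalence

variable (R : Type v) [CommRing R] {A : Type u} [Ring A] [Algebra R A]
  {Γ : Type u} [Ring Γ] [Algebra R Γ]
  [IsNoetherianRing A] [HasDerivedCategory.{w₁} (FGModuleCat.{u} A)]
  [IsNoetherianRing Γ] [HasDerivedCategory.{w₂} (FGModuleCat.{u} Γ)]

/-! ### Derived equivalences -/

lemma nontrivial_of_equivalence [Nontrivial A] (e : Db A ≌ Db Γ) : Nontrivial Γ := by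
  refine not_subsingleton_iff_nontrivial.1 fun h => not_subsingleton A ?_
  have h' : IsZero (e.functor.obj (stalk A)) := isZero_of_subsingleton _
  exact fg_subsingleton_of_isZero (isZero_of_boundedSingle (n := 0)
    ((e.inverse.map_isZero h').of_iso (e.unitIso.app (stalk A))))

/-- An object corresponding to the stalk complex `Γ` under an equivalence with `D^b(Γ)` has no
morphisms to a given module placed in very negative degrees. -/
lemma exists_hom_single_eq_zero_of_equivalence (e : Db A ≌ Db Γ) [e.functor.CommShift ℤ] {X : Db A}
    (i : e.functor.obj X ≅ stalk Γ) (S : FGModuleCat.{u} A) :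
    ∃ N : ℤ, ∀ m < N,
      ∀ f : X.obj ⟶ (DerivedCategory.singleFunctor (FGModuleCat.{u} A) m).obj S, f = 0 := by
  obtain ⟨N, hN⟩ := exists_hom_stalk_shift_eq_zero (e.functor.obj ((boundedSingle A 0).obj S))
  refine ⟨-N, fun m hm f => ?_⟩
  let g : X ⟶ (boundedSingle A m).obj S := ⟨f⟩
  suffices hg : g = 0 from congrArg (fun g => g.hom) hg
  let j := boundedSingleShiftIso S (-m) m 0 (by lia)
  rw [← cancel_mono j.inv, zero_comp]
  refine e.functor.map_injective ?_
  rw [← cancel_epi i.inv, ← cancel_mono ((e.functor.commShiftIso (-m)).hom.app _), Functor.map_zero,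
    comp_zero, zero_comp]
  exact hN (-m) (by lia) _

/-- A local Artinian algebra is Morita equivalent to every algebra with an equivalent bounded derived
category. -/
theorem isMoritaEquivalent_of_equivalence [IsLocalRing A] [IsArtinianRing A]
    (e : Db A ≌ Db Γ) [e.functor.CommShift ℤ] [e.functor.Additive] (he : e.functor.Linear R) :
    IsMoritaEquivalent R A Γ := by
  obtain ⟨I, hI⟩ := Ideal.exists_maximal A
  have hΓ : Nontrivial Γ := nontrivial_of_equivalence e
  let X := e.inverse.obj (stalk Γ)
  let i : e.functor.obj X ≅ stalk Γ := e.counitIso.app (stalk Γ)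
  have hX₀ : ¬IsZero X := fun h => not_subsingleton Γ (fg_subsingleton_of_isZero
    (isZero_of_boundedSingle (n := 0) ((e.functor.map_isZero h).of_iso i.symm)))
  have hX : IsExceptional X := IsExceptional.of_map e.functor (isExceptional_stalk.of_iso i.symm)
  obtain ⟨N, hN⟩ := exists_hom_single_eq_zero_of_equivalence e i (FGModuleCat.of A (A ⧸ I))
  obtain ⟨b, n, ⟨j⟩⟩ := exists_iso_boundedSingle I hI hX₀ hX hN
  have hn : n ≠ 0 := by
    rintro rfl
    exact hX₀ (((boundedSingle A b).map_isZero (fg_isZero_of_subsingleton _)).of_iso j)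
  have : Nonempty (Fin n) := ⟨⟨0, Nat.pos_of_ne_zero hn⟩⟩
  -- Compare the endomorphism algebras of `Γ` and `A ^ n`, which correspond to each other.
  let E₁ : End (stalk Γ) ≃ₐ[R] Γᵐᵒᵖ :=
    ((mapEndAlgEquiv R (boundedSingle Γ 0) (FGModuleCat.of Γ Γ)).symm.trans
      (fgEndAlgEquiv R Γ)).trans (AlgEquiv.moduleEndSelf R).symm
  let E₂ : End X ≃ₐ[R] (Matrix (Fin n) (Fin n) A)ᵐᵒᵖ :=
    (isoEndAlgEquiv R j).trans (((mapEndAlgEquiv R (boundedSingle A b) _).symm.trans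
      (fgEndAlgEquiv R (Fin n → A))).trans (endFreeAlgEquiv R n))
  let E : (Matrix (Fin n) (Fin n) A)ᵐᵒᵖ ≃ₐ[R] Γᵐᵒᵖ :=
    E₂.symm.trans (((mapEndAlgEquiv R e.functor X).trans (isoEndAlgEquiv R i)).trans E₁)
  exact (IsMoritaEquivalent.matrix A R).trans R (IsMoritaEquivalent.of_algEquiv R (AlgEquiv.op.symm E))

end Equivalence

end DerivedLocal

theorem corollary2p7 (k : Type v) [Field k] (A : Type u) [Ring A] [Algebra k A]
    [FiniteDimensional k A] [IsLocalRing A] :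
    haveI : IsNoetherianRing A := IsNoetherianRing.of_finite k A
    ∀ [HasDerivedCategory.{w₁} (FGModuleCat.{u} A)] [HasDerivedCategory.{w₂} (ModuleCat.{u} A)],
      (∀ X : DerivedLocal.Db A,
        Indecomposable X → DerivedLocal.IsCompact X → DerivedLocal.IsExceptional X →
          ∃ n : ℤ, Nonempty (X ≅ (DerivedLocal.stalk A)⟦n⟧)) ∧
      (∀ (Γ : Type u) [Ring Γ] [Algebra k Γ] [FiniteDimensional k Γ],
        haveI : IsNoetherianRing Γ := IsNoetherianRing.of_finite k Γ
        ∀ [HasDerivedCategory.{w₃} (FGModuleCat.{u} Γ)],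
          (DerivedLocal.TriangleEquivalent (DerivedLocal.Db A) (DerivedLocal.Db Γ) →
            IsMoritaEquivalent ℤ A Γ) ∧
          (DerivedLocal.LinearTriangleEquivalent k (DerivedLocal.Db A) (DerivedLocal.Db Γ) →
            IsMoritaEquivalent k A Γ)) := by
  have : IsNoetherianRing A := IsNoetherianRing.of_finite k A
  have : IsArtinianRing A := IsArtinianRing.of_finite k A
  intro _ _
  refine ⟨fun X hX hc he => ?_, fun Γ _ _ _ => ?_⟩
  · obtain ⟨I, hI⟩ := Ideal.exists_maximal A
    obtain ⟨N, hN⟩ := hc.exists_hom_single_eq_zero (FGModuleCat.of A (A ⧸ I))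
    obtain ⟨b, n, ⟨e⟩⟩ := DerivedLocal.exists_iso_boundedSingle I hI hX.1 he hN
    obtain rfl := DerivedLocal.eq_one_of_indecomposable hX e
    let e' : FGModuleCat.of A (Fin 1 → A) ≅ FGModuleCat.of A A :=
      (LinearEquiv.funUnique (Fin 1) A A).toFGModuleCatIso
    exact ⟨-b, ⟨e ≪≫ (DerivedLocal.boundedSingle A b).mapIso e' ≪≫
      (DerivedLocal.boundedSingleShiftIso (FGModuleCat.of A A) (-b) b 0 (by lia)).symm⟩⟩
  · have : IsNoetherianRing Γ := IsNoetherianRing.of_finite k Γ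
    intro _
    refine ⟨?_, ?_⟩
    · rintro ⟨e, _, _⟩
      exact DerivedLocal.isMoritaEquivalent_of_equivalence ℤ e (DerivedLocal.linear_int e.functor)
    · rintro ⟨e, _, _, he⟩
      exact DerivedLocal.isMoritaEquivalent_of_equivalence k e he
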